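/- Let $d_1,d_2\in\{0,1,2,\dots\}$ with $d=d_1+d_2>0$, and let $(I_{n,t},\varepsilon_{n,t})_{1\le t\le n,\ n\in\mathbb N}$ be a triangular array of random variables on a probability space $(\Omega,\mathcal A,P)$, where $I_{n,t}=(X_{n,t},Z_{n,t})$, $X_{n,t}$ takes values in $\mathbb N_0^{d_1}$, $Z_{n,t}$ takes values in $\mathbb R^{d_2}$, and $\varepsilon_{n,t}$ is real. Let $f:D\to\mathbb R$, $D\subseteq\mathbb N_0^{d_1}\times\mathbb R^{d_2}$. Suppose the following. **(A2)** (i) The errors are square integrable and, for some $\bar\sigma<\infty$ and all $1\le t\le n$, almost surely $$E(\varepsilon_{n,t}\mid I_{n,1},\dots,I_{n,t},\varepsilon_{n,1},\dots,\varepsilon_{n,t-1})=0,\qquad E(\varepsilon_{n,t}^2\mid I_{n,1},\dots,I_{n,t},\varepsilon_{n,1},\dots,\varepsilon_{n,t-1})\le\bar\sigma^2 .$$ (ii) With the strong mixing coefficients $$\alpha(r)=\sup\bigl\{|P(A\cap B)-P(A)P(B)| : m\ge1,\ n\ge m+r,\ A\in\sigma(I_{n,1},\dots,I_{n,m}),\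 B\in\sigma(I_{n,m+r},\dots,I_{n,n})\bigr\}$$ one has $\alpha(r)\to0$ and $\sum_{r=1}^\infty r^{d_2-1}\alpha(r)<\infty$. (iii) $f$ is bounded on $D$. **(A3)** Either for all $1\le t\le n$ all components of $Z_{n,t}$ have continuous marginal distribution functions, or one fixed component of $Z_{n,t}$ equals the trend $t/n$ for all $1\le t\le n$ and all other components have continuous marginal distribution functions. Moreover: (i) There are continuous distribution functions $G_1,\dots,G_{d_2}$ on $\mathbb R$ and, for every $K\in\mathbb N_0$, constants $0<C_1(K)\le C_2(K)<\infty$ such that for all $n\ge1$, all $k\in\{0,\dots,K\}^{d_1}$ and all real $a_i\le b_i$ $(1\le i\le d_2)$ $$\begin{aligned} C_1(K)\prod_{i=1}^{d_2}\bigl(G_i(b_i)-G_i(a_i)\bigr)-\frac1n &\le\frac1n\sum_{t=1}^nP\Bigl(X_{n,t}=k,\ Z_{n,t}\in\prod_{i=1}^{d_2}(a_i,b_i]\Bigr)\\ &\le\frac1n\sum_{t=1}^nP\Bigl(Z_{n,t}\in\prod_{i=1}^{d_2}(a_i,b_i]\Bigr)\le C_2(K)\prod_{i=1}^{d_2}\bigl(G_i(b_i)-G_i(a_i)\bigr)+\frac1n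 .\end{aligned}$$ (ii) There is a constant $C_3<\infty$ such that for all $1\le t\le n$ and all $d$-dimensional hyperrectangles $C$ (products of $d$ intervals $(a,b]$), almost surely $$P\bigl(I_{n,t}\in C\mid I_{n,1},\dots,I_{n,t-d},\varepsilon_{n,1},\dots,\varepsilon_{n,t-d}\bigr)\le C_3\,P(I_{n,t}\in C)$$ (no conditioning if $t\le d$). Put $\widetilde M_n=\lfloor n^{1/(d_2+2)}\rfloor$ and $\widetilde h_n=1/\widetilde M_n$. Let $G_i^{-1}:[0,1]\to[-\infty,\infty]$ be any inverse of $G_i$, that is, $G_i(G_i^{-1}(u))=u$ for all $u\in[0,1]$, where $G_i(-\infty)=0$ and $G_i(\infty)=1$ (for instance the quantile function). Fix $K\in\mathbb N_0$ and, for $k\in\widetilde K_n=\{0,\dots,K\}^{d_1}\times\{1,\dots,\widetilde M_n\}^{d_2}$, define the cell $$\widetilde B_k=\{(k_1,\dots,k_{d_1})\}\times\prod_{i=1}^{d_2}\bigl\{z\in\mathbb R: G_i^{-1}((k_{d_1+i}-1)\widetilde h_n)<z\le G_i^{-1}(k_{d_1+i}\widetilde h_n)\bigr\}.$$ For $C_4>0$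 let $$\widetilde A_n=\bigl\{\omega:\ \#\{t\le n: I_{n,t}(\omega)\in\widetilde B_k\}\ge C_4\,n^{2/(d_2+2)}\ \text{ for all }k\in\widetilde K_n\bigr\}.$$ Then there is $c>0$ such that for every $C_4\in(0,c]$ $$P(\widetilde A_n)\longrightarrow1\qquad(n\to\infty).$$ -/

import Mathlib

open MeasureTheory ProbabilityTheory Filter Topology

noncomputable section

namespace MixedIsotonic

variable {Ω : Type*}

/-- The information variable `I_{n,t} = (X_{n,t}, Z_{n,t})`: a discrete part with values in
`ℕ^{d₁}` (with `0 ∈ ℕ`) and a real part with values in `ℝ^{d₂}`. The first argument is the row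
`n` of the triangular array, the second one the time `t`, `1 ≤ t ≤ n`. -/
def infoVar {d₁ d₂ : ℕ} (X : ℕ → ℕ → Ω → Fin d₁ → ℕ) (Z : ℕ → ℕ → Ω → Fin d₂ → ℝ)
    (n t : ℕ) (ω : Ω) : (Fin d₁ → ℕ) × (Fin d₂ → ℝ) :=
  (X n t ω, Z n t ω)

/-- The σ-algebra generated by the variables `V s`, `s ∈ S`. -/
abbrev sigmaOf {β : Type*} [mβ : MeasurableSpace β] (V : ℕ → Ω → β) (S : Set ℕ) :
    MeasurableSpace Ω :=
  ⨆ s ∈ S, mβ.comap (V s)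

/-- The strong (`α`-) mixing coefficients of a triangular array `(I_{n,t})_{1 ≤ t ≤ n}`:
`α(r)` is the supremum, over all rows `n` and all times `m` with `1 ≤ m`, `m + r ≤ n`, of
`|P(A ∩ B) - P(A) P(B)|` over events `A` of the past `σ(I_{n,1}, …, I_{n,m})` and events `B` of the
future `σ(I_{n,m+r}, …, I_{n,n})`. -/
def strongMixingCoeff [MeasurableSpace Ω] (P : Measure Ω) {β : Type*} [MeasurableSpace β]
    (I : ℕ → ℕ → Ω → β) (r : ℕ) : ℝ :=
  sSup {x : ℝ | ∃ (n m : ℕ) (A B : Set Ω), 1 ≤ m ∧ m + r ≤ n ∧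
    MeasurableSet[sigmaOf (I n) (Set.Icc 1 m)] A ∧
    MeasurableSet[sigmaOf (I n) (Set.Icc (m + r) n)] B ∧
    x = |P.real (A ∩ B) - P.real A * P.real B|}

/-- A continuous distribution function on `ℝ`. -/
structure IsContinuousCDF (G : ℝ → ℝ) : Prop where
  monotone : Monotone G
  continuous : Continuous G
  atBot : Tendsto G atBot (𝓝 0)
  atTop : Tendsto G atTop (𝓝 1)

/-- `q` is an inverse `G⁻¹ : [0,1] → [-∞,∞]` of the distribution function `G`, which means
`G (q u) = u` for all `u ∈ [0,1]`, where `G (-∞) = 0` and `G (∞) = 1`. The inverse is unique up to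
the choice of a point where `G` is constant. -/
def IsInverseCDF (G : ℝ → ℝ) (q : ℝ → EReal) : Prop :=
  ∀ u ∈ Set.Icc (0 : ℝ) 1,
    (q u = ⊥ ∧ u = 0) ∨ (q u = ⊤ ∧ u = 1) ∨ ∃ x : ℝ, q u = (x : EReal) ∧ G x = u

/-- The usual quantile function `u ↦ inf {x : G x ≥ u}` is an inverse of `G`. -/
theorem IsContinuousCDF.isInverseCDF_sInf {G : ℝ → ℝ} (hG : IsContinuousCDF G) :
    IsInverseCDF G fun u => sInf ((fun x : ℝ => (x : EReal)) '' {x : ℝ | u ≤ G x}) := by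
  intro u hu
  have hle : ∀ x, G x ≤ 1 := fun x => hG.monotone.ge_of_tendsto hG.atTop x
  have hge : ∀ x, 0 ≤ G x := fun x => hG.monotone.le_of_tendsto hG.atBot x
  rcases hu.1.eq_or_lt with h0 | h0
  · left
    refine ⟨?_, h0.symm⟩
    rw [sInf_eq_bot]
    intro b hb
    obtain ⟨x, -, hx⟩ := EReal.lt_iff_exists_real_btwn.1 hb
    exact ⟨x, ⟨x, by simpa [← h0] using hge x, rfl⟩, hx⟩
  · by_cases hS : ∃ x, u ≤ G x
    · right; right
      obtain ⟨b, hb⟩ := hS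
      obtain ⟨a, ha⟩ : ∃ a, G a < u := (hG.atBot.eventually_lt_const h0).exists
      have hbdd : BddBelow {x : ℝ | u ≤ G x} := by
        refine ⟨a, fun x hx => ?_⟩
        by_contra hlt
        exact absurd (hG.monotone (not_le.1 hlt).le) (not_le.2 (ha.trans_le hx))
      have hne : {x : ℝ | u ≤ G x}.Nonempty := ⟨b, hb⟩
      have hcl : IsClosed {x : ℝ | u ≤ G x} := isClosed_le continuous_const hG.continuous
      have hmem : u ≤ G (sInf {x : ℝ | u ≤ G x}) := hcl.csInf_mem hne hbdd
      obtain ⟨y, hy⟩ : ∃ y, G y = u :=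
        mem_range_of_exists_le_of_exists_ge hG.continuous ⟨a, ha.le⟩ ⟨b, hb⟩
      refine ⟨sInf {x : ℝ | u ≤ G x}, ?_, le_antisymm ?_ hmem⟩
      · apply le_antisymm
        · exact sInf_le ⟨_, hmem, rfl⟩
        · refine le_sInf ?_
          rintro _ ⟨x, hx, rfl⟩
          exact EReal.coe_le_coe_iff.2 (csInf_le hbdd hx)
      · exact (hG.monotone (csInf_le hbdd hy.ge)).trans hy.le
    · right; left
      constructor
      · have : {x : ℝ | u ≤ G x} = ∅ := by
          ext x; simpa using fun h => hS ⟨x, h⟩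
        simp [this]
      · refine le_antisymm hu.2 (le_of_tendsto hG.atTop ?_)
        filter_upwards with x
        exact (not_le.1 fun h => hS ⟨x, h⟩).le

/-- The standing assumptions on the errors `ε_{n,t}`, on the dependence of the information variables,
and on the regression function `f` on its domain `D`. -/
structure ErrorMixingAssumption [MeasurableSpace Ω] (P : Measure Ω) {d₁ d₂ : ℕ}
    (X : ℕ → ℕ → Ω → Fin d₁ → ℕ) (Z : ℕ → ℕ → Ω → Fin d₂ → ℝ) (ε : ℕ → ℕ → Ω → ℝ)
    (D : Set ((Fin d₁ → ℕ) × (Fin d₂ → ℝ))) (f : (Fin d₁ → ℕ) × (Fin d₂ → ℝ) → ℝ) : Prop where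
  memLp : ∀ n t, 1 ≤ t → t ≤ n → MemLp (ε n t) 2 P
  condExp_eq_zero : ∀ n t, 1 ≤ t → t ≤ n →
    P[ε n t | sigmaOf (infoVar X Z n) (Set.Icc 1 t) ⊔ sigmaOf (ε n) (Set.Ico 1 t)] =ᵐ[P]
      fun _ => (0 : ℝ)
  condExp_sq_le : ∃ σ : ℝ, ∀ n t, 1 ≤ t → t ≤ n →
    P[fun ω => ε n t ω ^ 2 |
        sigmaOf (infoVar X Z n) (Set.Icc 1 t) ⊔ sigmaOf (ε n) (Set.Ico 1 t)] ≤ᵐ[P]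
      fun _ => σ ^ 2
  mixing : Tendsto (strongMixingCoeff P (infoVar X Z)) atTop (𝓝 0)
  summable_mixing : Summable fun r : ℕ =>
    ((r + 1 : ℕ) : ℝ) ^ ((d₂ : ℝ) - 1) * strongMixingCoeff P (infoVar X Z) (r + 1)
  bounded : ∃ b : ℝ, ∀ x ∈ D, |f x| ≤ b

/-- The standing assumptions on the distribution of the information variables;
`G 0, …, G (d₂ - 1)` are the continuous distribution functions in the bounds on the average
distribution. -/
structure DesignAssumption [MeasurableSpace Ω] (P : Measure Ω) {d₁ d₂ : ℕ}
    (X : ℕ → ℕ → Ω → Fin d₁ → ℕ) (Z : ℕ → ℕ → Ω → Fin d₂ → ℝ) (ε : ℕ → ℕ → Ω → ℝ)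
    (G : Fin d₂ → ℝ → ℝ) : Prop where
  /-- All components of `Z_{n,t}` have continuous marginal distribution functions, or one of them
  is the trend `t / n` and all others have continuous marginal distribution functions. -/
  marginals :
    (∀ i : Fin d₂, ∀ n t, 1 ≤ t → t ≤ n → Continuous (cdf (P.map fun ω => Z n t ω i))) ∨
    (∃ j : Fin d₂,
      (∀ n t, 1 ≤ t → t ≤ n → ∀ ω, Z n t ω j = (t : ℝ) / n) ∧
      ∀ i, i ≠ j → ∀ n t, 1 ≤ t → t ≤ n → Continuous (cdf (P.map fun ω => Z n t ω i)))
  isContinuousCDF : ∀ i, IsContinuousCDF (G i)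
  average_bounds : ∀ K : ℕ, ∃ C₁ C₂ : ℝ, 0 < C₁ ∧ C₁ ≤ C₂ ∧
    ∀ n : ℕ, 1 ≤ n → ∀ k : Fin d₁ → ℕ, (∀ i, k i ≤ K) →
    ∀ a b : Fin d₂ → ℝ, (∀ i, a i ≤ b i) →
      C₁ * ∏ i, (G i (b i) - G i (a i)) - 1 / (n : ℝ) ≤
        1 / (n : ℝ) * ∑ t ∈ Finset.Icc 1 n,
          P.real {ω | X n t ω = k ∧ ∀ i, Z n t ω i ∈ Set.Ioc (a i) (b i)} ∧
      1 / (n : ℝ) * ∑ t ∈ Finset.Icc 1 n,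
          P.real {ω | X n t ω = k ∧ ∀ i, Z n t ω i ∈ Set.Ioc (a i) (b i)} ≤
        1 / (n : ℝ) * ∑ t ∈ Finset.Icc 1 n,
          P.real {ω | ∀ i, Z n t ω i ∈ Set.Ioc (a i) (b i)} ∧
      1 / (n : ℝ) * ∑ t ∈ Finset.Icc 1 n,
          P.real {ω | ∀ i, Z n t ω i ∈ Set.Ioc (a i) (b i)} ≤
        C₂ * ∏ i, (G i (b i) - G i (a i)) + 1 / (n : ℝ)
  /-- The conditional probability of a hyperrectangle, given the variables and the errors up to
  time `t - d` with `d = d₁ + d₂`, is at most `C₃` times its probability. -/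
  condProb_le : ∃ C₃ : ℝ, ∀ n t, 1 ≤ t → t ≤ n →
    ∀ (a b : Fin d₁ → ℝ) (a' b' : Fin d₂ → ℝ),
      P⟦{ω | (∀ i, (X n t ω i : ℝ) ∈ Set.Ioc (a i) (b i)) ∧
            ∀ i, Z n t ω i ∈ Set.Ioc (a' i) (b' i)} |
          sigmaOf (infoVar X Z n) {s | 1 ≤ s ∧ s + (d₁ + d₂) ≤ t} ⊔
            sigmaOf (ε n) {s | 1 ≤ s ∧ s + (d₁ + d₂) ≤ t}⟧ ≤ᵐ[P]
        fun _ => C₃ * P.real {ω | (∀ i, (X n t ω i : ℝ) ∈ Set.Ioc (a i) (b i)) ∧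
            ∀ i, Z n t ω i ∈ Set.Ioc (a' i) (b' i)}

/-- The number `M_n = ⌊n^{1/(d₂+2)}⌋` of grid cells in each real direction. -/
def gridSize (d₂ n : ℕ) : ℕ := ⌊(n : ℝ) ^ (1 / ((d₂ : ℝ) + 2))⌋₊

/-- The cell with index `(k, l)`, `k ∈ {0, …, K}^{d₁}`, `l ∈ {1, …, M_n}^{d₂}`, which is
`{k} × ∏ᵢ (Gᵢ⁻¹((lᵢ - 1) h_n), Gᵢ⁻¹(lᵢ h_n)]` with `h_n = 1 / M_n`, where `q i` stands for
`Gᵢ⁻¹`. -/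
def cell {d₁ d₂ : ℕ} (q : Fin d₂ → ℝ → EReal) (n : ℕ) (k : Fin d₁ → ℕ) (l : Fin d₂ → ℕ) :
    Set ((Fin d₁ → ℕ) × (Fin d₂ → ℝ)) :=
  {x | x.1 = k ∧ ∀ i,
    q i (((l i : ℝ) - 1) * (1 / (gridSize d₂ n : ℝ))) < (x.2 i : EReal) ∧
    (x.2 i : EReal) ≤ q i ((l i : ℝ) * (1 / (gridSize d₂ n : ℝ)))}

/-- The event that each cell contains at least `C₄ n^{2/(d₂+2)}` of the observations
`I_{n,1}, …, I_{n,n}`. -/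
def cellEvent {d₁ d₂ : ℕ} (X : ℕ → ℕ → Ω → Fin d₁ → ℕ) (Z : ℕ → ℕ → Ω → Fin d₂ → ℝ)
    (q : Fin d₂ → ℝ → EReal) (K : ℕ) (C₄ : ℝ) (n : ℕ) : Set Ω :=
  {ω | ∀ (k : Fin d₁ → ℕ) (l : Fin d₂ → ℕ), (∀ i, k i ≤ K) →
    (∀ i, 1 ≤ l i ∧ l i ≤ gridSize d₂ n) →
    C₄ * (n : ℝ) ^ (2 / ((d₂ : ℝ) + 2)) ≤
      ({t : ℕ | 1 ≤ t ∧ t ≤ n ∧ infoVar X Z n t ω ∈ cell q n k l}.ncard : ℝ)}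

end MixedIsotonic

end

/-! Fix a cell and a bounded box inside it, let `p t` be the probability that the observation at
time `t` lies in the box, and let `L` be the sum of the `p t`. By `average_bounds`, `L` is at least
of order n · n^(-d₂/(d₂+2)) = n^(2/(d₂+2)). Time is cut into 2B consecutive blocks of mass at least
r, with B·r of order `L`, and only every other block is used. Inside a block, `condProb_le` bounds
the pair correlations and hence the second moment of the number of visits, so a Paley-Zygmund
argument gives at least r/2 visits with probability at least c = 1/(4(2d + C₃))
(`le_measureReal_half_le_eventCount`). Since `p t ≤ 1`, a skipped block has length at least r, so
the block events are independent up to α(r). A Chernoff bound that pays for mixing once per block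
(`measureReal_occurrences_le`) shows that fewer than (c/8)·B·r visits have probability at most
exp(-cB/4) + B·α(r) (`measureReal_eventCount_lt_le_exp`).

It remains to sum over the cells. In terms of y = n^(1/(4(d₂+2))) there are O(y^(4d₂)) cells and `L`
is at least of order y^8. If d₂ ≥ 1, summability and monotonicity give α(r) = O(r^(-d₂)), and B of
order y with r of order y^7 makes the union bound vanish. If d₂ = 0, the number of cells is bounded,
and a large constant B together with α(r) → 0 suffices. -/

namespace MixedIsotonic

/-! ### Moments of visit counts and a Chernoff bound for almost independent events. -/

section Counting

variable {Ω : Type*}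

/-- The number of indices `t ∈ T` for which the event `E t` occurs. -/
noncomputable def eventCount (E : ℕ → Set Ω) (T : Finset ℕ) (ω : Ω) : ℝ :=
  ∑ t ∈ T, (E t).indicator (fun _ => (1 : ℝ)) ω

theorem eventCount_nonneg (E : ℕ → Set Ω) (T : Finset ℕ) (ω : Ω) : 0 ≤ eventCount E T ω :=
  Finset.sum_nonneg fun _ _ => Set.indicator_nonneg (fun _ _ => zero_le_one) _

theorem measurable_eventCount [MeasurableSpace Ω] {E : ℕ → Set Ω} {T : Finset ℕ}
    (hE : ∀ t ∈ T, MeasurableSet (E t)) : Measurable (eventCount E T) :=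
  Finset.measurable_fun_sum T fun t ht => measurable_const.indicator (hE t ht)

theorem measurableSet_le_eventCount [MeasurableSpace Ω] {E : ℕ → Set Ω} {T : Finset ℕ}
    (hE : ∀ t ∈ T, MeasurableSet (E t)) (x : ℝ) : MeasurableSet {ω | x ≤ eventCount E T ω} :=
  measurableSet_le measurable_const (measurable_eventCount hE)

theorem integral_eventCount [MeasurableSpace Ω] (P : Measure Ω) [IsProbabilityMeasure P]
    {E : ℕ → Set Ω} {T : Finset ℕ} (hE : ∀ t ∈ T, MeasurableSet (E t)) :
    Integrable (eventCount E T) P ∧ ∫ ω, eventCount E T ω ∂P = ∑ t ∈ T, P.real (E t) := by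
  have h : ∀ t ∈ T, Integrable ((E t).indicator fun _ => (1 : ℝ)) P := fun t ht =>
    (integrable_const 1).indicator (hE t ht)
  refine ⟨integrable_finsetSum T h, ?_⟩
  simp only [eventCount]
  rw [integral_finsetSum T h]
  refine Finset.sum_congr rfl fun t ht => ?_
  rw [integral_indicator_const _ (hE t ht)]
  simp

theorem integral_eventCount_sq [MeasurableSpace Ω] (P : Measure Ω) [IsProbabilityMeasure P]
    {E : ℕ → Set Ω} {T : Finset ℕ} (hE : ∀ t ∈ T, MeasurableSet (E t)) :
    Integrable (fun ω => eventCount E T ω ^ 2) P ∧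
      ∫ ω, eventCount E T ω ^ 2 ∂P = ∑ s ∈ T, ∑ t ∈ T, P.real (E s ∩ E t) := by
  have heq : (fun ω => eventCount E T ω ^ 2) =
      fun ω => ∑ s ∈ T, ∑ t ∈ T, (E s ∩ E t).indicator (fun _ => (1 : ℝ)) ω := by
    funext ω
    simp only [eventCount, sq, Finset.sum_mul_sum]
    refine Finset.sum_congr rfl fun s _ => Finset.sum_congr rfl fun t _ => ?_
    by_cases h1 : ω ∈ E s <;> by_cases h2 : ω ∈ E t <;> simp [h1, h2]
  have h : ∀ s ∈ T, ∀ t ∈ T, Integrable ((E s ∩ E t).indicator fun _ => (1 : ℝ)) P :=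
    fun s hs t ht => (integrable_const 1).indicator ((hE s hs).inter (hE t ht))
  rw [heq]
  refine ⟨integrable_finsetSum T fun s hs => integrable_finsetSum T fun t ht => h s hs t ht, ?_⟩
  rw [integral_finsetSum T fun s hs => integrable_finsetSum T fun t ht => h s hs t ht]
  refine Finset.sum_congr rfl fun s hs => ?_
  rw [integral_finsetSum T fun t ht => h s hs t ht]
  refine Finset.sum_congr rfl fun t ht => ?_
  rw [integral_indicator_const _ ((hE s hs).inter (hE t ht))]
  simp

/-- If events at distance at least `d` are positively correlated by at most a constant factor, then
the second moment of their number is bounded in terms of its mean. -/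
theorem sum_sum_measureReal_inter_le [MeasurableSpace Ω] (P : Measure Ω) [IsProbabilityMeasure P]
    {E : ℕ → Set Ω} {T : Finset ℕ} {d : ℕ} {C : ℝ} (hC : 0 ≤ C)
    (hpair : ∀ s ∈ T, ∀ t ∈ T, s + d ≤ t → P.real (E s ∩ E t) ≤ C * (P.real (E s) * P.real (E t))) :
    ∑ s ∈ T, ∑ t ∈ T, P.real (E s ∩ E t) ≤
      2 * d * ∑ t ∈ T, P.real (E t) + C * (∑ t ∈ T, P.real (E t)) ^ 2 := by
  -- The interval consists of the `t` at distance less than `d` from `s`, at most `2 * d` of them.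
  -- For these the trivial bound by `P.real (E s)` is used; truncated subtraction only shortens the
  -- interval.
  have hpt : ∀ s ∈ T, ∀ t ∈ T, P.real (E s ∩ E t) ≤
      (if t ∈ Finset.Ico (s + 1 - d) (s + d) then P.real (E s) else 0) +
        C * (P.real (E s) * P.real (E t)) := by
    intro s hs t ht
    have hpos : 0 ≤ C * (P.real (E s) * P.real (E t)) := by positivity
    split_ifs with h
    · have : P.real (E s ∩ E t) ≤ P.real (E s) := measureReal_mono Set.inter_subset_left
      linarith
    · rw [zero_add]
      have h' : s + d ≤ t ∨ t + d ≤ s := by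
        simp only [Finset.mem_Ico] at h
        omega
      rcases h' with h' | h'
      · exact hpair s hs t ht h'
      · rw [Set.inter_comm, mul_comm (P.real (E s))]
        exact hpair t ht s hs h'
  have hnear : ∀ s ∈ T, ∑ t ∈ T, (if t ∈ Finset.Ico (s + 1 - d) (s + d) then P.real (E s) else 0) ≤
      2 * d * P.real (E s) := by
    intro s _
    rw [← Finset.sum_filter, Finset.sum_const, nsmul_eq_mul]
    refine mul_le_mul_of_nonneg_right ?_ measureReal_nonneg
    have h1 : (T.filter (· ∈ Finset.Ico (s + 1 - d) (s + d))).card ≤ 2 * d := by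
      refine (Finset.card_le_card (t := Finset.Ico (s + 1 - d) (s + d)) ?_).trans ?_
      · intro x hx
        exact (Finset.mem_filter.1 hx).2
      · rw [Nat.card_Ico]
        omega
    exact_mod_cast h1
  calc ∑ s ∈ T, ∑ t ∈ T, P.real (E s ∩ E t)
      ≤ ∑ s ∈ T, (2 * d * P.real (E s) + ∑ t ∈ T, C * (P.real (E s) * P.real (E t))) := by
        refine Finset.sum_le_sum fun s hs => ?_
        refine (Finset.sum_le_sum fun t ht => hpt s hs t ht).trans ?_
        rw [Finset.sum_add_distrib]
        exact add_le_add (hnear s hs) le_rfl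
    _ = _ := by
        rw [Finset.sum_add_distrib, ← Finset.mul_sum, sq, Finset.sum_mul_sum, Finset.mul_sum]
        simp only [Finset.mul_sum]

/-- A Paley-Zygmund inequality for the number of events. -/
theorem le_measureReal_half_le_eventCount [MeasurableSpace Ω] (P : Measure Ω)
    [IsProbabilityMeasure P] {E : ℕ → Set Ω} {T : Finset ℕ} {d : ℕ} {C : ℝ} (hC : 0 < C)
    (hE : ∀ t ∈ T, MeasurableSet (E t))
    (hpair : ∀ s ∈ T, ∀ t ∈ T, s + d ≤ t → P.real (E s ∩ E t) ≤ C * (P.real (E s) * P.real (E t)))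
    (hm : 1 ≤ ∑ t ∈ T, P.real (E t)) :
    1 / (4 * (2 * d + C)) ≤
      P.real {ω | (∑ t ∈ T, P.real (E t)) / 2 ≤ eventCount E T ω} := by
  set m := ∑ t ∈ T, P.real (E t) with hmdef
  set κ : ℝ := 2 * d + C with hκ
  have hκ0 : 0 < κ := by positivity
  set H := {ω | m / 2 ≤ eventCount E T ω} with hH
  have hHm : MeasurableSet H := measurableSet_le_eventCount hE _
  obtain ⟨hi1, he1⟩ := integral_eventCount P hE
  obtain ⟨hi2, he2⟩ := integral_eventCount_sq P hE
  have hsecond : ∫ ω, eventCount E T ω ^ 2 ∂P ≤ κ * m ^ 2 := by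
    rw [he2]
    refine (sum_sum_measureReal_inter_le P hC.le hpair).trans ?_
    rw [← hmdef, hκ]
    -- Here `1 ≤ m` turns the linear term of the second moment into a quadratic one.
    have : (d : ℝ) * m ≤ d * m ^ 2 := mul_le_mul_of_nonneg_left (by nlinarith) (by positivity)
    nlinarith
  have hm0 : 0 < m := by linarith
  -- This replaces Cauchy-Schwarz: x ≤ x²/(4κm) + κm on `H` by AM-GM, and x < m/2 off `H`.
  -- Integration yields m ≤ m/2 + m/4 + κm·P(H).
  have hpt : ∀ ω, eventCount E T ω ≤
      m / 2 + (1 / (4 * κ * m) * eventCount E T ω ^ 2 + κ * m * H.indicator (fun _ => (1 : ℝ)) ω) := by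
    intro ω
    set x := eventCount E T ω with hx
    by_cases h : ω ∈ H
    · rw [Set.indicator_of_mem h]
      have h0 : 1 / (4 * κ * m) * x ^ 2 + κ * m * 1 - x = (x - 2 * κ * m) ^ 2 / (4 * κ * m) := by
        field_simp
        ring
      have h1 : 0 ≤ (x - 2 * κ * m) ^ 2 / (4 * κ * m) := by positivity
      linarith
    · rw [Set.indicator_of_notMem h]
      have h0 : 0 ≤ 1 / (4 * κ * m) * x ^ 2 := by positivity
      have h1 : x < m / 2 := not_le.1 h
      linarith
  have hind : Integrable (H.indicator fun _ => (1 : ℝ)) P := (integrable_const 1).indicator hHm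
  have hi3 : Integrable (fun ω => 1 / (4 * κ * m) * eventCount E T ω ^ 2) P := hi2.const_mul _
  have hi4 : Integrable (fun ω => κ * m * H.indicator (fun _ => (1 : ℝ)) ω) P := hind.const_mul _
  have hi5 : Integrable (fun ω => 1 / (4 * κ * m) * eventCount E T ω ^ 2 +
      κ * m * H.indicator (fun _ => (1 : ℝ)) ω) P := hi3.add hi4
  have hint := integral_mono hi1 ((integrable_const (m / 2)).add hi5) hpt
  have hadd : ∫ ω, m / 2 + (1 / (4 * κ * m) * eventCount E T ω ^ 2 +
      κ * m * H.indicator (fun _ => (1 : ℝ)) ω) ∂P =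
      m / 2 + (1 / (4 * κ * m) * ∫ ω, eventCount E T ω ^ 2 ∂P + κ * m * P.real H) := by
    rw [integral_add (integrable_const _) hi5, integral_add hi3 hi4, integral_const_mul,
      integral_const_mul, integral_indicator_const _ hHm]
    simp
  have hint : m ≤ m / 2 + (1 / (4 * κ * m) * ∫ ω, eventCount E T ω ^ 2 ∂P + κ * m * P.real H) := by
    rw [← hadd]
    exact he1.symm.trans_le hint
  have h3 : 1 / (4 * κ * m) * ∫ ω, eventCount E T ω ^ 2 ∂P ≤ m / 4 := by
    refine (mul_le_mul_of_nonneg_left hsecond (by positivity)).trans (le_of_eq ?_)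
    field_simp
  have h4 : m * (1 / 4) ≤ m * (κ * P.real H) := by linarith
  have h5 := le_of_mul_le_mul_left h4 hm0
  rw [div_le_iff₀ (by positivity)]
  linarith

/-- The number of the events `H 0, …, H (b - 1)` that occur. -/
noncomputable def occurrences (H : ℕ → Set Ω) (b : ℕ) (ω : Ω) : ℕ :=
  ∑ i ∈ Finset.range b, (H i).indicator (fun _ => 1) ω

theorem measurable_occurrences [MeasurableSpace Ω] {H : ℕ → Set Ω} {b : ℕ}
    (hH : ∀ i < b, MeasurableSet (H i)) : Measurable (occurrences H b) :=
  Finset.measurable_fun_sum _ fun i hi =>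
    measurable_const.indicator (hH i (Finset.mem_range.1 hi))

theorem occurrences_succ (H : ℕ → Set Ω) (b : ℕ) (ω : Ω) :
    occurrences H (b + 1) ω = occurrences H b ω + (H b).indicator (fun _ => 1) ω :=
  Finset.sum_range_succ _ _

/-- A lower tail bound for the number of occurrences of almost independent events, all of which
have probability at least `c`. -/
theorem measureReal_occurrences_le [MeasurableSpace Ω] (P : Measure Ω) [IsProbabilityMeasure P]
    {H : ℕ → Set Ω} {B : ℕ} {c a : ℝ} (hc0 : 0 ≤ c) (hc1 : c ≤ 1) (ha : 0 ≤ a)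
    (hH : ∀ i < B, MeasurableSet (H i))
    (hmix : ∀ b < B, ∀ j : ℕ, P.real ({ω | occurrences H b ω = j} ∩ (H b)ᶜ) ≤
      P.real {ω | occurrences H b ω = j} * (1 - c) + a) :
    ∀ b ≤ B, ∀ j : ℕ, P.real {ω | occurrences H b ω ≤ j} ≤
      Real.exp j * (1 - c * (1 - Real.exp (-1))) ^ b + b * a := by
  -- ρ = c·e⁻¹ + (1 - c) is the mean of e^(-ξ) for a Bernoulli(c) variable ξ, so e^j·ρ^b is the
  -- bound that Markov's inequality gives in the independent case.
  set ρ := 1 - c * (1 - Real.exp (-1)) with hρ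
  have hexp : Real.exp (-1) ≤ 1 := by simp
  have hexp0 := Real.exp_pos (-1)
  have hρ0 : 0 ≤ ρ := by nlinarith
  intro b
  induction b with
  | zero =>
    intro _ j
    simp only [pow_zero, mul_one, Nat.cast_zero, zero_mul, add_zero]
    exact measureReal_le_one.trans (Real.one_le_exp (Nat.cast_nonneg j))
  | succ b ih =>
    intro hb j
    have hbB : b < B := hb
    have ih := ih hbB.le
    have hmeas : Measurable (occurrences H b) :=
      measurable_occurrences fun i hi => hH i (hi.trans hbB)
    have hmj : ∀ i : ℕ, MeasurableSet {ω | occurrences H b ω = i} := fun i =>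
      hmeas (measurableSet_singleton i)
    have hm := hmix b hbB j
    rcases j with _ | j
    · have hsub : {ω | occurrences H (b + 1) ω ≤ 0} ⊆ {ω | occurrences H b ω = 0} ∩ (H b)ᶜ := by
        intro ω hω
        simp only [Set.mem_ofPred_eq, occurrences_succ] at hω
        by_cases h : ω ∈ H b
        · simp [h] at hω
        · exact ⟨by simpa [h] using hω, h⟩
      have h1 := measureReal_mono (μ := P) hsub
      have h2 : P.real {ω | occurrences H b ω = 0} ≤ Real.exp (0 : ℕ) * ρ ^ b + b * a := by
        have := ih 0
        simpa only [Nat.le_zero] using this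
      have h3 : (1 - c) ≤ ρ := by nlinarith
      have h4 : P.real {ω | occurrences H b ω = 0} * (1 - c) ≤
          (Real.exp (0 : ℕ) * ρ ^ b + b * a) * (1 - c) :=
        mul_le_mul_of_nonneg_right h2 (by linarith)
      have h5 : Real.exp (0 : ℕ) * ρ ^ b * (1 - c) ≤ Real.exp (0 : ℕ) * ρ ^ b * ρ :=
        mul_le_mul_of_nonneg_left h3 (by positivity)
      have h6 : b * a * (1 - c) ≤ b * a := mul_le_of_le_one_right (by positivity) (by linarith)
      rw [pow_succ]
      push_cast at *
      linarith
    -- Writing N for the count over the first b events, the new tail is at most P(N ≤ j) + (1 -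
    -- c)·P(N = j+1) + a = c·P(N ≤ j) + (1 - c)·P(N ≤ j+1) + a. The function e^j·ρ^b solves this
    -- recursion with a = 0, and each step adds a single error `a`.
    · have hsub : {ω | occurrences H (b + 1) ω ≤ j + 1} ⊆
          {ω | occurrences H b ω ≤ j} ∪ ({ω | occurrences H b ω = (j + 1 : ℕ)} ∩ (H b)ᶜ) := by
        intro ω hω
        simp only [Set.mem_ofPred_eq, occurrences_succ] at hω
        by_cases h : ω ∈ H b
        · left
          simpa [h] using hω
        · rw [Set.indicator_of_notMem h, add_zero] at hω
          rcases Nat.le_succ_iff.1 hω with h' | h'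
          · exact Or.inl h'
          · exact Or.inr ⟨h', h⟩
      have h1 := (measureReal_mono (μ := P) hsub).trans (measureReal_union_le _ _)
      have hsplit : P.real {ω | occurrences H b ω ≤ j + 1} =
          P.real {ω | occurrences H b ω ≤ j} + P.real {ω | occurrences H b ω = (j + 1 : ℕ)} := by
        rw [← measureReal_union _ (hmj _)]
        · congr 1
          ext ω
          simp only [Set.mem_ofPred_eq, Set.mem_union]
          omega
        · rw [Set.disjoint_left]
          intro ω h1 h2
          simp only [Set.mem_ofPred_eq] at h1 h2
          omega
      have i1 := mul_le_mul_of_nonneg_left (ih j) hc0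
      have i2 := mul_le_mul_of_nonneg_left (ih (j + 1)) (sub_nonneg.2 hc1)
      have hej : Real.exp (j : ℕ) = Real.exp ((j + 1 : ℕ) : ℝ) * Real.exp (-1) := by
        rw [← Real.exp_add]
        push_cast
        ring_nf
      rw [hej] at i1
      have heq : Real.exp ((j + 1 : ℕ) : ℝ) * ρ ^ (b + 1) =
          c * (Real.exp ((j + 1 : ℕ) : ℝ) * Real.exp (-1) * ρ ^ b) +
            (1 - c) * (Real.exp ((j + 1 : ℕ) : ℝ) * ρ ^ b) := by
        rw [pow_succ, hρ]
        ring
      rw [heq]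
      have hcast : ((b + 1 : ℕ) : ℝ) * a = b * a + a := by push_cast; ring
      rw [hcast]
      rw [hsplit] at i2
      nlinarith

end Counting

/-! ### Alternating blocks and the lower tail of the number of visits to one set. -/

section Blocks

variable {Ω : Type*}

/-- At the first passage over level `x` the overshoot is below 1, because each increment is at most
1. -/
theorem exists_partialSum_mem_Ico {p : ℕ → ℝ} (hp1 : ∀ t, p t ≤ 1) {n : ℕ} {x : ℝ} (hx0 : 0 ≤ x)
    (hx : x ≤ ∑ t ∈ Finset.Icc 1 n, p t) :
    ∃ t ≤ n, x ≤ ∑ s ∈ Finset.Icc 1 t, p s ∧ ∑ s ∈ Finset.Icc 1 t, p s < x + 1 := by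
  classical
  have hex : ∃ t, x ≤ ∑ s ∈ Finset.Icc 1 t, p s := ⟨n, hx⟩
  refine ⟨Nat.find hex, Nat.find_min' hex hx, Nat.find_spec hex, ?_⟩
  rcases h : Nat.find hex with _ | u
  · simp only [zero_lt_one, Finset.Icc_eq_empty_of_lt, Finset.sum_empty]
    linarith
  · have hu : ∑ s ∈ Finset.Icc 1 u, p s < x := not_le.1 (Nat.find_min hex (by omega))
    rw [Finset.sum_Icc_succ_top (by omega)]
    have := hp1 (u + 1)
    linarith

theorem partialSum_sub {p : ℕ → ℝ} {u v : ℕ} (h : u ≤ v) :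
    ∑ t ∈ Finset.Ioc u v, p t = ∑ t ∈ Finset.Icc 1 v, p t - ∑ t ∈ Finset.Icc 1 u, p t := by
  have : Finset.Icc 1 v = Finset.Icc 1 u ∪ Finset.Ioc u v := by
    ext x
    simp only [Finset.mem_union, Finset.mem_Icc, Finset.mem_Ioc]
    omega
  rw [this, Finset.sum_union, add_sub_cancel_left]
  rw [Finset.disjoint_left]
  intro x
  simp only [Finset.mem_Icc, Finset.mem_Ioc]
  omega

/-- Weights in `[0, 1]` with a large total admit consecutive blocks, all of mass and length at
least `r`. -/
theorem exists_blocks {p : ℕ → ℝ} (hp0 : ∀ t, 0 ≤ p t) (hp1 : ∀ t, p t ≤ 1) {n r N : ℕ}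
    (hmass : (N : ℝ) * (r + 1) ≤ ∑ t ∈ Finset.Icc 1 n, p t) :
    ∃ τ : ℕ → ℕ, (∀ j ≤ N, τ j ≤ n) ∧
      ∀ j < N, τ j + r ≤ τ (j + 1) ∧ (r : ℝ) ≤ ∑ t ∈ Finset.Ioc (τ j) (τ (j + 1)), p t := by
  -- The levels are spaced by `r + 1` rather than `r`: the extra 1 absorbs the overshoot, so that
  -- each block still has mass at least `r`.
  have hex : ∀ j : ℕ, ∃ t, j ≤ N → t ≤ n ∧ (j : ℝ) * (r + 1) ≤ ∑ s ∈ Finset.Icc 1 t, p s ∧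
      ∑ s ∈ Finset.Icc 1 t, p s < (j : ℝ) * (r + 1) + 1 := by
    intro j
    by_cases hj : j ≤ N
    · obtain ⟨t, ht⟩ := exists_partialSum_mem_Ico hp1 (n := n) (x := (j : ℝ) * (r + 1))
        (by positivity)
        (le_trans (mul_le_mul_of_nonneg_right (by exact_mod_cast hj) (by positivity)) hmass)
      exact ⟨t, fun _ => ht⟩
    · exact ⟨0, fun h => absurd h hj⟩
  choose τ hτ using hex
  refine ⟨τ, fun j hj => (hτ j hj).1, fun j hj => ?_⟩
  obtain ⟨-, h1, h2⟩ := hτ j hj.le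
  obtain ⟨-, h3, h4⟩ := hτ (j + 1) hj
  push_cast at h3 h4
  have hr0 : (0 : ℝ) ≤ r := Nat.cast_nonneg r
  have hle : τ j ≤ τ (j + 1) := by
    by_contra hlt
    have : ∑ s ∈ Finset.Icc 1 (τ (j + 1)), p s ≤ ∑ s ∈ Finset.Icc 1 (τ j), p s :=
      Finset.sum_le_sum_of_subset_of_nonneg
        (Finset.Icc_subset_Icc_right (not_le.1 hlt).le) fun _ _ _ => hp0 _
    linarith
  have hsum : (r : ℝ) ≤ ∑ t ∈ Finset.Ioc (τ j) (τ (j + 1)), p t := by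
    rw [partialSum_sub hle]
    linarith
  refine ⟨?_, hsum⟩
  -- Weights of at most 1 make the length of a block at least its mass.
  have hcard : ∑ t ∈ Finset.Ioc (τ j) (τ (j + 1)), p t ≤ ((τ (j + 1) - τ j : ℕ) : ℝ) := by
    refine (Finset.sum_le_card_nsmul _ _ 1 fun t _ => hp1 t).trans ?_
    simp
  have : r ≤ τ (j + 1) - τ j := by exact_mod_cast hsum.trans hcard
  omega

theorem measurableSet_sigmaOf_preimage {β : Type*} [MeasurableSpace β] {V : ℕ → Ω → β} {S : Set ℕ}
    {t : ℕ} (ht : t ∈ S) {C : Set β} (hC : MeasurableSet C) :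
    MeasurableSet[sigmaOf V S] (V t ⁻¹' C) :=
  (le_iSup₂ (f := fun s (_ : s ∈ S) => MeasurableSpace.comap (V s) inferInstance) t ht) _
    ⟨C, hC, rfl⟩

theorem sigmaOf_le [mΩ : MeasurableSpace Ω] {β : Type*} [MeasurableSpace β] {V : ℕ → Ω → β}
    {S : Set ℕ} (hV : ∀ t ∈ S, Measurable (V t)) : sigmaOf V S ≤ mΩ :=
  iSup₂_le fun t ht => (hV t ht).comap_le

theorem eventCount_union_le {E : ℕ → Set Ω} {T₁ T₂ T : Finset ℕ} (hd : Disjoint T₁ T₂)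
    (h1 : T₁ ⊆ T) (h2 : T₂ ⊆ T) (ω : Ω) :
    eventCount E T₁ ω + eventCount E T₂ ω ≤ eventCount E T ω := by
  rw [eventCount, eventCount, ← Finset.sum_union hd]
  exact Finset.sum_le_sum_of_subset_of_nonneg (Finset.union_subset h1 h2)
    fun _ _ _ => Set.indicator_nonneg (fun _ _ => zero_le_one) _

/-- A lower tail bound for the number of visits of a mixing process to a set. -/
theorem measureReal_eventCount_lt_le [MeasurableSpace Ω] (P : Measure Ω) [IsProbabilityMeasure P]
    {β : Type*} [MeasurableSpace β] {V : ℕ → Ω → β} {n : ℕ}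
    (hV : ∀ t, 1 ≤ t → t ≤ n → Measurable (V t)) {C : Set β} (hC : MeasurableSet C) {d : ℕ}
    {C₃ : ℝ} (hC₃ : 1 ≤ C₃) {r B : ℕ} (hr : 1 ≤ r) {a : ℝ} (ha : 0 ≤ a)
    (hmix : ∀ (m : ℕ) (A A' : Set Ω), 1 ≤ m → m + r ≤ n →
      MeasurableSet[sigmaOf V (Set.Icc 1 m)] A → MeasurableSet[sigmaOf V (Set.Icc (m + r) n)] A' →
      |P.real (A ∩ A') - P.real A * P.real A'| ≤ a)
    (hpair : ∀ s t, 1 ≤ s → s + d ≤ t → t ≤ n → P.real (V s ⁻¹' C ∩ V t ⁻¹' C) ≤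
      C₃ * (P.real (V s ⁻¹' C) * P.real (V t ⁻¹' C)))
    (hmass : ((2 * B : ℕ) : ℝ) * (r + 1) ≤ ∑ t ∈ Finset.Icc 1 n, P.real (V t ⁻¹' C)) (j : ℕ) :
    P.real {ω | eventCount (fun t => V t ⁻¹' C) (Finset.Icc 1 n) ω < ((j : ℝ) + 1) * (r / 2)} ≤
      Real.exp j * (1 - 1 / (4 * (2 * d + C₃)) * (1 - Real.exp (-1))) ^ B + B * a := by
  obtain ⟨τ, hτn, hτ⟩ := exists_blocks (p := fun t => P.real (V t ⁻¹' C))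
    (fun _ => measureReal_nonneg) (fun _ => measureReal_le_one) hmass
  set E : ℕ → Set Ω := fun t => V t ⁻¹' C with hEdef
  -- Only the blocks with even index are used; the skipped ones are the gaps of length at least `r`
  -- that mixing needs.
  set T : ℕ → Finset ℕ := fun b => Finset.Ioc (τ (2 * b)) (τ (2 * b + 1)) with hT
  set H : ℕ → Set Ω := fun b => {ω | (r : ℝ) / 2 ≤ eventCount E (T b) ω} with hH
  have hmono : ∀ i j, i ≤ j → j ≤ 2 * B → τ i ≤ τ j := by
    intro i j hij
    induction j, hij using Nat.le_induction with
    | base => exact fun _ => le_rfl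
    | succ j _ ih => exact fun h => (ih (by omega)).trans (by have := hτ j (by omega); omega)
  have hEm : ∀ t, 1 ≤ t → t ≤ n → MeasurableSet (E t) := fun t h1 h2 => hV t h1 h2 hC
  have hTm : ∀ b < B, ∀ t ∈ T b, 1 ≤ t ∧ t ≤ n := by
    intro b hb t ht
    have h := hτn (2 * b + 1) (by omega)
    simp only [hT, Finset.mem_Ioc] at ht
    omega
  have hHm : ∀ b < B, MeasurableSet (H b) := fun b hb =>
    measurableSet_le_eventCount (fun t ht => hEm t (hTm b hb t ht).1 (hTm b hb t ht).2) _
  have hprob : ∀ b < B, 1 / (4 * (2 * d + C₃)) ≤ P.real (H b) := by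
    intro b hb
    have hmassb := (hτ (2 * b) (by omega)).2
    have hr' : (1 : ℝ) ≤ r := by exact_mod_cast hr
    refine (le_measureReal_half_le_eventCount P (E := E) (T := T b) (d := d) (by linarith)
      (fun t ht => hEm t (hTm b hb t ht).1 (hTm b hb t ht).2)
      (fun s hs t ht hst => hpair s t (hTm b hb s hs).1 hst (hTm b hb t ht).2)
      (hr'.trans hmassb)).trans (measureReal_mono ?_)
    intro ω hω
    have hω' : (∑ t ∈ T b, P.real (E t)) / 2 ≤ eventCount E (T b) ω := hω
    show (r : ℝ) / 2 ≤ eventCount E (T b) ω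
    exact le_trans (by linarith [hmassb]) hω'
  have hocc : ∀ b ≤ B, ∀ ω,
      (occurrences H b ω : ℝ) * (r / 2) ≤ eventCount E (Finset.Ioc 0 (τ (2 * b))) ω := by
    intro b
    induction b with
    | zero =>
      intro _ ω
      simpa [occurrences] using eventCount_nonneg E _ ω
    | succ b ih =>
      intro hb ω
      have h1 := ih (by omega) ω
      have t1 := hmono (2 * b) (2 * b + 1) (by omega) (by omega)
      have t2 := hmono (2 * b + 1) (2 * (b + 1)) (by omega) (by omega)
      have h2 : eventCount E (Finset.Ioc 0 (τ (2 * b))) ω + eventCount E (T b) ω ≤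
          eventCount E (Finset.Ioc 0 (τ (2 * (b + 1)))) ω := by
        apply eventCount_union_le
        · rw [Finset.disjoint_left]
          intro x
          simp only [hT, Finset.mem_Ioc]
          omega
        · exact Finset.Ioc_subset_Ioc_right (by omega)
        · exact Finset.Ioc_subset_Ioc (by omega) (by omega)
      rw [occurrences_succ]
      by_cases h : ω ∈ H b
      · have h' : (r : ℝ) / 2 ≤ eventCount E (T b) ω := h
        rw [Set.indicator_of_mem h]
        push_cast
        linarith
      · rw [Set.indicator_of_notMem h, add_zero]
        linarith [eventCount_nonneg E (T b) ω]
  have hmixH : ∀ b < B, ∀ j : ℕ, P.real ({ω | occurrences H b ω = j} ∩ (H b)ᶜ) ≤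
      P.real {ω | occurrences H b ω = j} * (1 - 1 / (4 * (2 * d + C₃))) + a := by
    intro b hb j
    have hcompl : P.real (H b)ᶜ ≤ 1 - 1 / (4 * (2 * d + C₃)) := by
      rw [probReal_compl_eq_one_sub (hHm b hb)]
      linarith [hprob b hb]
    refine le_trans ?_
      (add_le_add (mul_le_mul_of_nonneg_left hcompl measureReal_nonneg) (le_refl a))
    -- Before the first block the count is constantly 0, so no decoupling is needed. For later
    -- blocks the past ends at `τ (2 * b + 1)`, which is at least 1 since its block has length at
    -- least `r`.
    rcases b with _ | b
    · rcases j with _ | j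
      · simpa [occurrences] using ha
      · simpa [occurrences] using ha
    · have hlen := (hτ (2 * b + 1) (by omega)).1
      have hlen0 := (hτ (2 * b) (by omega)).1
      have hlen1 := (hτ (2 * (b + 1)) (by omega)).1
      have hn := hτn (2 * (b + 1) + 1) (by omega)
      rw [show 2 * b + 1 + 1 = 2 * (b + 1) by ring] at hlen
      have hA : MeasurableSet[sigmaOf V (Set.Icc 1 (τ (2 * b + 1)))]
          {ω | occurrences H (b + 1) ω = j} := by
        refine @measurable_occurrences Ω (sigmaOf V (Set.Icc 1 (τ (2 * b + 1)))) H (b + 1) ?_ _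
          (measurableSet_singleton j)
        intro i hi
        refine @measurableSet_le_eventCount Ω (sigmaOf V (Set.Icc 1 (τ (2 * b + 1)))) E (T i) ?_ _
        intro t ht
        refine measurableSet_sigmaOf_preimage ?_ hC
        have := hmono (2 * i + 1) (2 * b + 1) (by omega) (by omega)
        simp only [hT, Finset.mem_Ioc] at ht
        simp only [Set.mem_Icc]
        omega
      have hA' : MeasurableSet[sigmaOf V (Set.Icc (τ (2 * b + 1) + r) n)] (H (b + 1))ᶜ := by
        refine @MeasurableSet.compl Ω _ (sigmaOf V (Set.Icc (τ (2 * b + 1) + r) n)) ?_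
        refine @measurableSet_le_eventCount Ω (sigmaOf V (Set.Icc (τ (2 * b + 1) + r) n)) E
          (T (b + 1)) ?_ _
        intro t ht
        refine measurableSet_sigmaOf_preimage ?_ hC
        simp only [hT, Finset.mem_Ioc] at ht
        simp only [Set.mem_Icc]
        omega
      have := (abs_le.1 (hmix (τ (2 * b + 1)) _ _ (by omega) (by omega) hA hA')).2
      linarith
  have hc1 : 1 / (4 * (2 * (d : ℝ) + C₃)) ≤ 1 := by
    have : (0 : ℝ) ≤ d := Nat.cast_nonneg d
    rw [div_le_one (by positivity)]
    linarith
  refine le_trans (measureReal_mono ?_)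
    (measureReal_occurrences_le P (by positivity) hc1 ha hHm hmixH B le_rfl j)
  intro ω hω
  have hω' : eventCount E (Finset.Icc 1 n) ω < ((j : ℝ) + 1) * (r / 2) := hω
  have h1 := hocc B le_rfl ω
  have h2 : eventCount E (Finset.Ioc 0 (τ (2 * B))) ω ≤ eventCount E (Finset.Icc 1 n) ω := by
    refine Finset.sum_le_sum_of_subset_of_nonneg ?_
      fun _ _ _ => Set.indicator_nonneg (fun _ _ => zero_le_one) _
    intro x
    have := hτn (2 * B) le_rfl
    simp only [Finset.mem_Ioc, Finset.mem_Icc]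
    omega
  show occurrences H B ω ≤ j
  have hr0 : (0 : ℝ) < r / 2 := by
    have : (0 : ℝ) < r := by exact_mod_cast hr
    positivity
  have h3 : (occurrences H B ω : ℝ) < (j : ℝ) + 1 :=
    lt_of_mul_lt_mul_right (h1.trans_lt (h2.trans_lt hω')) hr0.le
  have h4 : occurrences H B ω < j + 1 := by exact_mod_cast h3
  omega

/-- A version of the lower tail bound with explicit exponents. -/
theorem measureReal_eventCount_lt_le_exp [MeasurableSpace Ω] (P : Measure Ω)
    [IsProbabilityMeasure P] {β : Type*} [MeasurableSpace β] {V : ℕ → Ω → β} {n : ℕ}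
    (hV : ∀ t, 1 ≤ t → t ≤ n → Measurable (V t)) {C : Set β} (hC : MeasurableSet C) {d : ℕ}
    {C₃ : ℝ} (hC₃ : 1 ≤ C₃) {r B : ℕ} (hr : 1 ≤ r) {a : ℝ} (ha : 0 ≤ a)
    (hmix : ∀ (m : ℕ) (A A' : Set Ω), 1 ≤ m → m + r ≤ n →
      MeasurableSet[sigmaOf V (Set.Icc 1 m)] A → MeasurableSet[sigmaOf V (Set.Icc (m + r) n)] A' →
      |P.real (A ∩ A') - P.real A * P.real A'| ≤ a)
    (hpair : ∀ s t, 1 ≤ s → s + d ≤ t → t ≤ n → P.real (V s ⁻¹' C ∩ V t ⁻¹' C) ≤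
      C₃ * (P.real (V s ⁻¹' C) * P.real (V t ⁻¹' C)))
    (hmass : ((2 * B : ℕ) : ℝ) * (r + 1) ≤ ∑ t ∈ Finset.Icc 1 n, P.real (V t ⁻¹' C)) {c : ℝ}
    (hc : c = 1 / (4 * (2 * d + C₃))) :
    P.real {ω | eventCount (fun t => V t ⁻¹' C) (Finset.Icc 1 n) ω < c / 8 * (B * r)} ≤
      Real.exp (-(c / 4 * B)) + B * a := by
  have hd : (0 : ℝ) ≤ d := Nat.cast_nonneg d
  have hc0 : 0 < c := by rw [hc]; positivity
  have hc1 : c ≤ 1 := by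
    rw [hc, div_le_one (by positivity)]
    linarith
  -- As e⁻¹ ≤ 1/2, the base is at most 1 - c/2 ≤ e^(-c/2). With j = ⌊cB/4⌋ the factor e^j uses up
  -- only half of the exponent cB/2, while (j + 1)·r/2 exceeds c·B·r/8.
  have h := measureReal_eventCount_lt_le P hV hC hC₃ hr ha hmix hpair hmass ⌊c * B / 4⌋₊
  rw [← hc] at h
  have hB0 : (0 : ℝ) ≤ B := Nat.cast_nonneg B
  have hr0 : (0 : ℝ) ≤ r := Nat.cast_nonneg r
  refine (measureReal_mono ?_).trans (h.trans (add_le_add ?_ le_rfl))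
  · intro ω hω
    refine lt_of_lt_of_le (Set.mem_ofPred_eq ▸ hω) ?_
    have := Nat.lt_floor_add_one (c * B / 4)
    nlinarith
  · have he : Real.exp (-1) ≤ 1 / 2 := by
      rw [Real.exp_neg, inv_le_comm₀ (Real.exp_pos _) (by norm_num)]
      have := Real.add_one_le_exp (1 : ℝ)
      linarith
    have h1 : 1 - c * (1 - Real.exp (-1)) ≤ Real.exp (-(c / 2)) := by
      have := Real.add_one_le_exp (-(c / 2))
      nlinarith
    have h0 : 0 ≤ 1 - c * (1 - Real.exp (-1)) := by
      have := Real.exp_pos (-1)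
      nlinarith
    have h2 : (1 - c * (1 - Real.exp (-1))) ^ B ≤ Real.exp (-(c / 2) * B) := by
      rw [mul_comm (-(c / 2)), Real.exp_nat_mul]
      exact pow_le_pow_left₀ h0 h1 B
    have h3 : Real.exp (⌊c * B / 4⌋₊ : ℝ) ≤ Real.exp (c * B / 4) :=
      Real.exp_le_exp.2 (Nat.floor_le (by positivity))
    refine (mul_le_mul h3 h2 (pow_nonneg h0 B) (Real.exp_pos _).le).trans (le_of_eq ?_)
    rw [← Real.exp_add]
    ring_nf

end Blocks

/-! ### Monotonicity and decay of the strong mixing coefficients. -/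

section Mixing

variable {Ω : Type*} [MeasurableSpace Ω] (P : Measure Ω) [IsProbabilityMeasure P]
  {β : Type*} [MeasurableSpace β] (I : ℕ → ℕ → Ω → β)

theorem abs_measureReal_inter_sub_le_one (A B : Set Ω) :
    |P.real (A ∩ B) - P.real A * P.real B| ≤ 1 := by
  have h1 : P.real (A ∩ B) ≤ 1 := measureReal_le_one
  have h2 : P.real A * P.real B ≤ 1 :=
    mul_le_one₀ measureReal_le_one measureReal_nonneg measureReal_le_one
  have h3 : 0 ≤ P.real (A ∩ B) := measureReal_nonneg
  have h4 : 0 ≤ P.real A * P.real B := by positivity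
  rw [abs_le]
  constructor <;> linarith

/-- A real `sSup` dominates the elements of its set only if the set is bounded above; otherwise it
takes the default value 0. -/
theorem bddAbove_mixing_set (r : ℕ) :
    BddAbove {x : ℝ | ∃ (n m : ℕ) (A B : Set Ω), 1 ≤ m ∧ m + r ≤ n ∧
      MeasurableSet[sigmaOf (I n) (Set.Icc 1 m)] A ∧
      MeasurableSet[sigmaOf (I n) (Set.Icc (m + r) n)] B ∧
      x = |P.real (A ∩ B) - P.real A * P.real B|} := by
  refine ⟨1, ?_⟩
  rintro x ⟨n, m, A, B, -, -, -, -, rfl⟩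
  exact abs_measureReal_inter_sub_le_one P A B

theorem abs_sub_le_strongMixingCoeff {n m r : ℕ} {A B : Set Ω} (hm : 1 ≤ m) (hn : m + r ≤ n)
    (hA : MeasurableSet[sigmaOf (I n) (Set.Icc 1 m)] A)
    (hB : MeasurableSet[sigmaOf (I n) (Set.Icc (m + r) n)] B) :
    |P.real (A ∩ B) - P.real A * P.real B| ≤ strongMixingCoeff P I r :=
  le_csSup (bddAbove_mixing_set P I r) ⟨n, m, A, B, hm, hn, hA, hB, rfl⟩

theorem strongMixingCoeff_nonneg {Ω : Type*} [MeasurableSpace Ω] (P : Measure Ω) {β : Type*}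
    [MeasurableSpace β] (I : ℕ → ℕ → Ω → β) (r : ℕ) : 0 ≤ strongMixingCoeff P I r := by
  refine Real.sSup_nonneg ?_
  rintro x ⟨n, m, A, B, -, -, -, -, rfl⟩
  exact abs_nonneg _

theorem strongMixingCoeff_antitone : Antitone (strongMixingCoeff P I) := by
  intro r s hrs
  refine csSup_le_csSup (bddAbove_mixing_set P I r) ?_ ?_
  -- `csSup_le_csSup` needs the smaller set to be nonempty; the empty events in row `1 + s` provide
  -- an element.
  · exact ⟨_, 1 + s, 1, ∅, ∅, le_rfl, le_rfl,
      MeasurableSpace.measurableSet_empty _, MeasurableSpace.measurableSet_empty _, rfl⟩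
  · rintro x ⟨n, m, A, B, hm, hn, hA, hB, rfl⟩
    refine ⟨n, m, A, B, hm, by omega, hA, ?_, rfl⟩
    have hle : sigmaOf (I n) (Set.Icc (m + s) n) ≤ sigmaOf (I n) (Set.Icc (m + r) n) :=
      biSup_mono fun t ht => Set.Icc_subset_Icc_left (by omega) ht
    exact hle _ hB

/-- Summability of `r ^ (d - 1) α(r)` makes `r ^ d α(r)` bounded. -/
theorem exists_pow_mul_strongMixingCoeff_le {d : ℕ} (hd : 1 ≤ d)
    (hs : Summable fun r : ℕ =>
      ((r + 1 : ℕ) : ℝ) ^ ((d : ℝ) - 1) * strongMixingCoeff P I (r + 1)) :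
    ∃ A : ℝ, 0 ≤ A ∧ ∀ r : ℕ, (r : ℝ) ^ d * strongMixingCoeff P I r ≤ A := by
  set f : ℕ → ℝ := fun r => ((r + 1 : ℕ) : ℝ) ^ ((d : ℝ) - 1) * strongMixingCoeff P I (r + 1)
  have hf0 : ∀ r, 0 ≤ f r := fun r =>
    mul_nonneg (Real.rpow_nonneg (Nat.cast_nonneg _) _) (strongMixingCoeff_nonneg P I _)
  refine ⟨2 ^ d * ∑' r, f r, mul_nonneg (by positivity) (tsum_nonneg hf0), fun r => ?_⟩
  -- Since α is antitone, each of the at least r/2 summands with r/2 < s + 1 ≤ r dominates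
  -- (r/2)^(d-1)·α(r). Their sum is bounded by the whole series.
  have hterm : ∀ s ∈ Finset.Ico (r / 2) r,
      ((r : ℝ) / 2) ^ (d - 1) * strongMixingCoeff P I r ≤ f s := by
    intro s hs
    rw [Finset.mem_Ico] at hs
    refine mul_le_mul ?_ (strongMixingCoeff_antitone P I (by omega))
      (strongMixingCoeff_nonneg P I _) (by positivity)
    rw [show (d : ℝ) - 1 = ((d - 1 : ℕ) : ℝ) by push_cast [hd]; ring, Real.rpow_natCast]
    refine pow_le_pow_left₀ (by positivity) ?_ _
    have : r ≤ (s + 1) * 2 := by omega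
    rw [div_le_iff₀ (by norm_num)]
    exact_mod_cast this
  have hsum := (Finset.card_nsmul_le_sum _ _ _ hterm).trans
    (hs.sum_le_tsum (Finset.Ico (r / 2) r) fun i _ => hf0 i)
  rw [Nat.card_Ico, nsmul_eq_mul] at hsum
  have hcard : (r : ℝ) / 2 ≤ ((r - r / 2 : ℕ) : ℝ) := by
    have : r ≤ (r - r / 2) * 2 := by omega
    rw [div_le_iff₀ (by norm_num)]
    exact_mod_cast this
  have h0 : 0 ≤ ((r : ℝ) / 2) ^ (d - 1) * strongMixingCoeff P I r :=
    mul_nonneg (by positivity) (strongMixingCoeff_nonneg P I _)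
  have h1 := (mul_le_mul_of_nonneg_right hcard h0).trans hsum
  have h2 : (r : ℝ) ^ d * strongMixingCoeff P I r =
      2 ^ d * ((r : ℝ) / 2 * (((r : ℝ) / 2) ^ (d - 1) * strongMixingCoeff P I r)) := by
    rw [← mul_assoc ((r : ℝ) / 2), ← pow_succ', Nat.sub_add_cancel hd, div_pow]
    field_simp
  rw [h2]
  exact mul_le_mul_of_nonneg_left h1 (by positivity)

end Mixing

/-! ### Bounded boxes inside the cells. -/

section Cells

variable {d₁ d₂ : ℕ}

/-- The bounded box `{k} × ∏ᵢ (aᵢ, bᵢ]`. -/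
def box (k : Fin d₁ → ℕ) (a b : Fin d₂ → ℝ) : Set ((Fin d₁ → ℕ) × (Fin d₂ → ℝ)) :=
  {x | x.1 = k ∧ ∀ i, x.2 i ∈ Set.Ioc (a i) (b i)}

theorem measurableSet_box (k : Fin d₁ → ℕ) (a b : Fin d₂ → ℝ) : MeasurableSet (box k a b) := by
  have : box k a b = Prod.fst ⁻¹' {k} ∩
      ⋂ i, (fun x : (Fin d₁ → ℕ) × (Fin d₂ → ℝ) => x.2 i) ⁻¹' Set.Ioc (a i) (b i) := by
    ext x
    simp [box]
  rw [this]
  exact (measurable_fst (measurableSet_singleton k)).inter (MeasurableSet.iInter fun i =>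
    ((measurable_pi_apply i).comp measurable_snd) measurableSet_Ioc)

/-- The outer cells may be unbounded, whereas the design bounds concern finite endpoints. An
infinite endpoint is cut off at the cost of at most a quarter of the mass on each side. -/
theorem IsContinuousCDF.exists_subinterval {G : ℝ → ℝ} (hG : IsContinuousCDF G) {q : ℝ → EReal}
    (hq : IsInverseCDF G q) {u v : ℝ} (hu : 0 ≤ u) (huv : u < v) (hv : v ≤ 1) :
    ∃ a b : ℝ, a ≤ b ∧ q u ≤ a ∧ (b : EReal) ≤ q v ∧ (v - u) / 2 ≤ G b - G a := by
  obtain ⟨a, ha, hGa⟩ : ∃ a : ℝ, q u ≤ a ∧ G a ≤ u + (v - u) / 4 := by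
    rcases hq u ⟨hu, by linarith⟩ with ⟨h, h0⟩ | ⟨-, h1⟩ | ⟨x, hx, hGx⟩
    · obtain ⟨a, ha⟩ :=
        (hG.atBot.eventually_lt_const (show (0 : ℝ) < u + (v - u) / 4 by linarith)).exists
      exact ⟨a, by simp [h], ha.le⟩
    · linarith
    · exact ⟨x, hx.le, by linarith⟩
  obtain ⟨b, hb, hGb⟩ : ∃ b : ℝ, (b : EReal) ≤ q v ∧ v - (v - u) / 4 ≤ G b := by
    rcases hq v ⟨by linarith, hv⟩ with ⟨-, h0⟩ | ⟨h, h1⟩ | ⟨x, hx, hGx⟩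
    · linarith
    · obtain ⟨b, hb⟩ :=
        (hG.atTop.eventually_const_lt (show v - (v - u) / 4 < (1 : ℝ) by linarith)).exists
      exact ⟨b, by simp [h], hb.le⟩
    · exact ⟨x, hx.ge, by linarith⟩
  refine ⟨a, b, ?_, ha, hb, by linarith⟩
  by_contra hlt
  have := hG.monotone (not_le.1 hlt).le
  linarith

/-- Each cell contains a bounded box whose sides have at least half the mass of the sides of the
cell. -/
theorem exists_box_subset_cell {G : Fin d₂ → ℝ → ℝ} (hG : ∀ i, IsContinuousCDF (G i))
    {q : Fin d₂ → ℝ → EReal} (hq : ∀ i, IsInverseCDF (G i) (q i)) {n : ℕ} (k : Fin d₁ → ℕ)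
    {l : Fin d₂ → ℕ} (hM : 1 ≤ gridSize d₂ n) (hl : ∀ i, 1 ≤ l i ∧ l i ≤ gridSize d₂ n) :
    ∃ a b : Fin d₂ → ℝ, (∀ i, a i ≤ b i) ∧ box k a b ⊆ cell q n k l ∧
      ∀ i, 1 / (2 * (gridSize d₂ n : ℝ)) ≤ G i (b i) - G i (a i) := by
  have hM0 : (0 : ℝ) < gridSize d₂ n := by exact_mod_cast hM
  have h : ∀ i, ∃ a b : ℝ, a ≤ b ∧ q i (((l i : ℝ) - 1) * (1 / (gridSize d₂ n : ℝ))) ≤ a ∧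
      (b : EReal) ≤ q i ((l i : ℝ) * (1 / (gridSize d₂ n : ℝ))) ∧
      1 / (2 * (gridSize d₂ n : ℝ)) ≤ G i b - G i a := by
    intro i
    have h1 : (1 : ℝ) ≤ l i := by exact_mod_cast (hl i).1
    have h2 : (l i : ℝ) ≤ gridSize d₂ n := by exact_mod_cast (hl i).2
    obtain ⟨a, b, hab, ha, hb, hGab⟩ := (hG i).exists_subinterval (hq i)
      (u := ((l i : ℝ) - 1) * (1 / (gridSize d₂ n : ℝ)))
      (v := (l i : ℝ) * (1 / (gridSize d₂ n : ℝ)))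
      (mul_nonneg (by linarith) (by positivity))
      (mul_lt_mul_of_pos_right (by linarith) (by positivity))
      (by rw [mul_one_div, div_le_one hM0]; exact h2)
    refine ⟨a, b, hab, ha, hb, le_trans (le_of_eq ?_) hGab⟩
    field_simp
    ring
  choose a b hab ha hb hGab using h
  refine ⟨a, b, hab, ?_, hGab⟩
  rintro x ⟨hx1, hx2⟩
  refine ⟨hx1, fun i => ⟨(ha i).trans_lt ?_, le_trans ?_ (hb i)⟩⟩
  · exact_mod_cast (hx2 i).1
  · exact_mod_cast (hx2 i).2

end Cells

/-! ### Pair correlations and expected visits from the design assumptions. -/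

section Design

theorem measureReal_inter_le_of_condExp_le {Ω : Type*} {m m0 : MeasurableSpace Ω} {P : Measure Ω}
    [IsProbabilityMeasure P] (hm : m ≤ m0) {A A' : Set Ω} (hA : MeasurableSet[m] A)
    (hA' : MeasurableSet A') {c : ℝ} (h : P⟦A' | m⟧ ≤ᵐ[P] fun _ => c) :
    P.real (A ∩ A') ≤ c * P.real A := by
  have hint : Integrable (A'.indicator fun _ => (1 : ℝ)) P :=
    (integrable_const 1).indicator hA'
  have h1 : P.real (A ∩ A') = ∫ ω in A, (P⟦A' | m⟧) ω ∂P := by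
    rw [setIntegral_condExp hm hint hA, integral_indicator_const _ hA']
    simp [measureReal_restrict_apply hA', Set.inter_comm]
  have h2 : ∫ ω in A, (P⟦A' | m⟧) ω ∂P ≤ ∫ _ in A, c ∂P :=
    setIntegral_mono_ae integrable_condExp.integrableOn (integrable_const _).integrableOn h
  rw [setIntegral_const, smul_eq_mul] at h2
  rw [h1]
  linarith

variable {Ω : Type*} [MeasurableSpace Ω] {P : Measure Ω} {d₁ d₂ : ℕ}
  {X : ℕ → ℕ → Ω → Fin d₁ → ℕ} {Z : ℕ → ℕ → Ω → Fin d₂ → ℝ} {ε : ℕ → ℕ → Ω → ℝ}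
  {G : Fin d₂ → ℝ → ℝ}

/-- The visit at time `s` belongs to the conditioning σ-algebra of time `t` because `s + (d₁ + d₂) ≤
t`, so the conditional bound may be integrated over it. -/
theorem DesignAssumption.exists_measureReal_inter_le [IsProbabilityMeasure P]
    (hX : ∀ n t, 1 ≤ t → t ≤ n → Measurable (X n t))
    (hZ : ∀ n t, 1 ≤ t → t ≤ n → Measurable (Z n t))
    (hε : ∀ n t, 1 ≤ t → t ≤ n → Measurable (ε n t))
    (hA3 : DesignAssumption P X Z ε G) :
    ∃ C₃ : ℝ, 1 ≤ C₃ ∧ ∀ (n s t : ℕ), 1 ≤ s → s + (d₁ + d₂) ≤ t → t ≤ n →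
      ∀ (k : Fin d₁ → ℕ) (a b : Fin d₂ → ℝ),
        P.real (infoVar X Z n s ⁻¹' box k a b ∩ infoVar X Z n t ⁻¹' box k a b) ≤
          C₃ * (P.real (infoVar X Z n s ⁻¹' box k a b) *
            P.real (infoVar X Z n t ⁻¹' box k a b)) := by
  obtain ⟨C, hC⟩ := hA3.condProb_le
  -- The constant is enlarged to at least 1 so that 1/(4(2d + C₃)) is a positive number not
  -- exceeding 1.
  refine ⟨max C 1, le_max_right _ _, fun n s t hs hst ht k a b => ?_⟩
  have hI : ∀ u, 1 ≤ u → u ≤ n → Measurable (infoVar X Z n u) := fun u h1 h2 =>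
    (hX n u h1 h2).prodMk (hZ n u h1 h2)
  have hFle : sigmaOf (infoVar X Z n) {s | 1 ≤ s ∧ s + (d₁ + d₂) ≤ t} ⊔
      sigmaOf (ε n) {s | 1 ≤ s ∧ s + (d₁ + d₂) ≤ t} ≤ ‹MeasurableSpace Ω› := sup_le
    (sigmaOf_le fun u hu => hI u hu.1 (by have := hu.2; omega))
    (sigmaOf_le fun u hu => hε n u hu.1 (by have := hu.2; omega))
  -- The only integer in (k - 1, k] is k, so a box with fixed discrete part is a hyperrectangle in
  -- all d₁ + d₂ coordinates.
  have hbox : {ω | (∀ i, (X n t ω i : ℝ) ∈ Set.Ioc ((k i : ℝ) - 1) (k i)) ∧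
      ∀ i, Z n t ω i ∈ Set.Ioc (a i) (b i)} = infoVar X Z n t ⁻¹' box k a b := by
    ext ω
    simp only [Set.mem_ofPred_eq, Set.mem_preimage, box, infoVar]
    refine and_congr_left fun _ => ⟨fun h => funext fun i => ?_, fun h i => ?_⟩
    · obtain ⟨h1, h2⟩ := h i
      have h2' : X n t ω i ≤ k i := by exact_mod_cast h2
      have h1' : k i < X n t ω i + 1 := by
        have : (k i : ℝ) < X n t ω i + 1 := by linarith
        exact_mod_cast this
      omega
    · rw [h]
      exact ⟨by linarith, le_rfl⟩
  have hcond := hC n t (by omega) ht (fun i => (k i : ℝ) - 1) (fun i => (k i : ℝ)) a b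
  rw [hbox] at hcond
  have hAF : MeasurableSet[sigmaOf (infoVar X Z n) {s | 1 ≤ s ∧ s + (d₁ + d₂) ≤ t}]
      (infoVar X Z n s ⁻¹' box k a b) :=
    measurableSet_sigmaOf_preimage (Set.mem_ofPred_eq ▸ ⟨hs, hst⟩) (measurableSet_box k a b)
  have h1 := measureReal_inter_le_of_condExp_le hFle (le_sup_left (a := sigmaOf _ _) _ hAF)
    (hI t (by omega) ht (measurableSet_box k a b)) hcond
  have h3 : 0 ≤ P.real (infoVar X Z n s ⁻¹' box k a b) *
      P.real (infoVar X Z n t ⁻¹' box k a b) := by positivity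
  have := mul_le_mul_of_nonneg_right (le_max_left C 1) h3
  linarith

/-- The expected number of visits to a box is of order at least `n ∏ᵢ (Gᵢ bᵢ - Gᵢ aᵢ)`. -/
theorem DesignAssumption.exists_le_sum_measureReal (hA3 : DesignAssumption P X Z ε G) (K : ℕ) :
    ∃ C₁ : ℝ, 0 < C₁ ∧ ∀ n : ℕ, 1 ≤ n → ∀ k : Fin d₁ → ℕ, (∀ i, k i ≤ K) →
      ∀ a b : Fin d₂ → ℝ, (∀ i, a i ≤ b i) → ∀ w : ℝ, 0 ≤ w →
      (∀ i, w ≤ G i (b i) - G i (a i)) →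
      C₁ * (n * w ^ d₂) - 1 ≤
        ∑ t ∈ Finset.Icc 1 n, P.real (infoVar X Z n t ⁻¹' box k a b) := by
  obtain ⟨C₁, C₂, hC₁, -, h⟩ := hA3.average_bounds K
  refine ⟨C₁, hC₁, fun n hn k hk a b hab w hw hGw => ?_⟩
  have h1 := (h n hn k hk a b hab).1
  have h2 : w ^ d₂ ≤ ∏ i, (G i (b i) - G i (a i)) := by
    have := Finset.prod_le_prod (s := Finset.univ) (f := fun _ : Fin d₂ => w)
      (fun _ _ => hw) fun i _ => hGw i
    simpa using this
  have hn0 : (0 : ℝ) < n := by exact_mod_cast hn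
  have h3 := (sub_le_sub_right (mul_le_mul_of_nonneg_left h2 hC₁.le) (1 / (n : ℝ))).trans h1
  have h4 := mul_le_mul_of_nonneg_left h3 hn0.le
  rw [← mul_assoc, mul_one_div_cancel hn0.ne', one_mul, mul_sub, mul_one_div_cancel hn0.ne'] at h4
  refine le_trans (le_of_eq ?_) h4
  ring

end Design

/-! ### The union bound over all cells. -/

section Union

variable {Ω : Type*} {d₁ d₂ : ℕ}
  {X : ℕ → ℕ → Ω → Fin d₁ → ℕ} {Z : ℕ → ℕ → Ω → Fin d₂ → ℝ}

theorem eventCount_le_ncard {n : ℕ} {b C : Set ((Fin d₁ → ℕ) × (Fin d₂ → ℝ))} (hb : b ⊆ C)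
    (ω : Ω) :
    eventCount (fun t => infoVar X Z n t ⁻¹' b) (Finset.Icc 1 n) ω ≤
      ({t : ℕ | 1 ≤ t ∧ t ≤ n ∧ infoVar X Z n t ω ∈ C}.ncard : ℝ) := by
  classical
  have h1 : eventCount (fun t => infoVar X Z n t ⁻¹' b) (Finset.Icc 1 n) ω =
      (((Finset.Icc 1 n).filter fun t => infoVar X Z n t ω ∈ b).card : ℝ) := by
    simp [eventCount, Set.indicator_apply]
  rw [h1, ← Set.ncard_coe_finset]
  have hfin : {t : ℕ | 1 ≤ t ∧ t ≤ n ∧ infoVar X Z n t ω ∈ C}.Finite :=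
    (Set.finite_Icc 1 n).subset fun t ht => ⟨ht.1, ht.2.1⟩
  refine Nat.cast_le.2 (Set.ncard_le_ncard ?_ hfin)
  intro t ht
  simp only [Finset.coe_filter, Finset.mem_Icc, Set.mem_ofPred_eq] at ht
  exact ⟨ht.1.1, ht.1.2, hb ht.2⟩

/-- If the lower tail of the number of visits to each cell is at most `δ`, then the complement of
the cell event has probability at most `δ` times the number of cells. -/
theorem measureReal_compl_cellEvent_le [MeasurableSpace Ω] {P : Measure Ω}
    [IsProbabilityMeasure P] {q : Fin d₂ → ℝ → EReal} {K n : ℕ} {C₄ δ : ℝ}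
    (h : ∀ (k : Fin d₁ → ℕ) (l : Fin d₂ → ℕ), (∀ i, k i ≤ K) →
      (∀ i, 1 ≤ l i ∧ l i ≤ gridSize d₂ n) → ∃ b ⊆ cell q n k l,
        P.real {ω | eventCount (fun t => infoVar X Z n t ⁻¹' b) (Finset.Icc 1 n) ω <
          C₄ * (n : ℝ) ^ (2 / ((d₂ : ℝ) + 2))} ≤ δ) :
    P.real (cellEvent X Z q K C₄ n)ᶜ ≤ ((K : ℝ) + 1) ^ d₁ * (gridSize d₂ n : ℝ) ^ d₂ * δ := by
  classical
  set S : Finset ((Fin d₁ → ℕ) × (Fin d₂ → ℕ)) :=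
    (Fintype.piFinset fun _ => Finset.range (K + 1)) ×ˢ
      (Fintype.piFinset fun _ => Finset.Icc 1 (gridSize d₂ n)) with hS
  set bad : (Fin d₁ → ℕ) × (Fin d₂ → ℕ) → Set Ω := fun c =>
    {ω | ({t : ℕ | 1 ≤ t ∧ t ≤ n ∧ infoVar X Z n t ω ∈ cell q n c.1 c.2}.ncard : ℝ) <
      C₄ * (n : ℝ) ^ (2 / ((d₂ : ℝ) + 2))} with hbad
  have hsub : (cellEvent X Z q K C₄ n)ᶜ ⊆ ⋃ c ∈ S, bad c := by
    intro ω hω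
    simp only [cellEvent, Set.mem_compl_iff, Set.mem_ofPred_eq, not_forall] at hω
    obtain ⟨k, l, hk, hl, hlt⟩ := hω
    refine Set.mem_iUnion₂.2 ⟨(k, l), ?_, not_le.1 hlt⟩
    simp only [hS, Finset.mem_product, Fintype.mem_piFinset, Finset.mem_range, Finset.mem_Icc]
    exact ⟨fun i => Nat.lt_succ_of_le (hk i), hl⟩
  have hcard : ((K : ℝ) + 1) ^ d₁ * (gridSize d₂ n : ℝ) ^ d₂ = (S.card : ℝ) := by
    simp [hS, Finset.card_product, Fintype.card_piFinset]
  rw [hcard, ← nsmul_eq_mul]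
  refine ((measureReal_mono hsub (measure_ne_top P _)).trans (measureReal_biUnion_finset_le S bad)).trans
    (Finset.sum_le_card_nsmul _ _ _ ?_)
  rintro ⟨k, l⟩ hc
  simp only [hS, Finset.mem_product, Fintype.mem_piFinset, Finset.mem_range, Finset.mem_Icc] at hc
  obtain ⟨b, hb, hδ⟩ := h k l (fun i => Nat.le_of_lt_succ (hc.1 i)) hc.2
  refine (measureReal_mono ?_).trans hδ
  intro ω hω
  exact (eventCount_le_ncard hb ω).trans_lt hω

end Union

/-! ### Rates, and the choice of the number and mass of the blocks. -/

section Asymptotics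

/-- The scale `n ^ (1 / (4 (d + 2)))`, in powers of which all rates are expressed. -/
noncomputable def rate (d n : ℕ) : ℝ := (n : ℝ) ^ (1 / (4 * ((d : ℝ) + 2)))

theorem tendsto_rate (d : ℕ) : Tendsto (rate d) atTop atTop :=
  (tendsto_rpow_atTop (by positivity)).comp tendsto_natCast_atTop_atTop

theorem rate_pow_eight (d n : ℕ) : rate d n ^ 8 = (n : ℝ) ^ (2 / ((d : ℝ) + 2)) := by
  rw [rate, ← Real.rpow_natCast, ← Real.rpow_mul (Nat.cast_nonneg n)]
  congr 1
  field_simp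
  norm_num

theorem rate_pow_four (d n : ℕ) : rate d n ^ 4 = (n : ℝ) ^ (1 / ((d : ℝ) + 2)) := by
  rw [rate, ← Real.rpow_natCast, ← Real.rpow_mul (Nat.cast_nonneg n)]
  congr 1
  field_simp
  norm_num

theorem rate_pow_eq (d n : ℕ) : rate d n ^ (4 * d + 8) = n := by
  rw [rate, ← Real.rpow_natCast, ← Real.rpow_mul (Nat.cast_nonneg n)]
  have : 1 / (4 * ((d : ℝ) + 2)) * ((4 * d + 8 : ℕ) : ℝ) = 1 := by
    push_cast
    field_simp
    ring
  rw [this, Real.rpow_one]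

theorem gridSize_le (d n : ℕ) : (gridSize d n : ℝ) ≤ rate d n ^ 4 := by
  rw [rate_pow_four]
  exact Nat.floor_le (Real.rpow_nonneg (Nat.cast_nonneg n) _)

theorem one_le_gridSize {d n : ℕ} (h : 1 ≤ rate d n) : 1 ≤ gridSize d n := by
  rw [gridSize, Nat.one_le_floor_iff, ← rate_pow_four]
  exact one_le_pow₀ h

/-- The volume of a cell of half the side length, times the number of observations. -/
theorem le_mul_half_cell {d n : ℕ} (h : 1 ≤ rate d n) :
    rate d n ^ 8 / 2 ^ d ≤ n * (1 / (2 * (gridSize d n : ℝ))) ^ d := by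
  have hM : (0 : ℝ) < gridSize d n := by exact_mod_cast one_le_gridSize h
  have hMd : (gridSize d n : ℝ) ^ d ≤ (rate d n ^ 4) ^ d :=
    pow_le_pow_left₀ hM.le (gridSize_le d n) d
  rw [one_div, inv_pow, mul_pow, ← div_eq_mul_inv, div_le_div_iff₀ (by positivity) (by positivity)]
  have hn : (n : ℝ) = rate d n ^ 8 * (rate d n ^ 4) ^ d := by
    rw [← pow_mul, ← pow_add, add_comm, rate_pow_eq]
  have h1 : rate d n ^ 8 * (2 ^ d * (gridSize d n : ℝ) ^ d) ≤
      rate d n ^ 8 * (2 ^ d * (rate d n ^ 4) ^ d) :=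
    mul_le_mul_of_nonneg_left (mul_le_mul_of_nonneg_left hMd (by positivity)) (by positivity)
  refine h1.trans (le_of_eq ?_)
  rw [← mul_assoc, mul_right_comm, ← hn]

/-- For a mass `L` and `B` blocks there is a block mass `r` of the right order. -/
theorem exists_blockMass {L : ℝ} {B : ℕ} (hB : 1 ≤ B) (hL : 8 * B ≤ L) :
    ∃ r : ℕ, 1 ≤ r ∧ ((2 * B : ℕ) : ℝ) * (r + 1) ≤ L ∧ L / 4 ≤ B * r := by
  have hB0 : (0 : ℝ) < B := by exact_mod_cast hB
  have h4 : (4 : ℝ) ≤ L / (2 * B) := by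
    rw [le_div_iff₀ (by positivity)]
    linarith
  have hfl : 4 ≤ ⌊L / (2 * B)⌋₊ := Nat.le_floor (by exact_mod_cast h4)
  have h1 := Nat.floor_le (show 0 ≤ L / (2 * B) by linarith)
  have h2 := Nat.lt_floor_add_one (L / (2 * B))
  -- Subtracting 1 makes room for the factor `r + 1`. The loss is harmless: B·r ≥ L/2 - 2B ≥ L/4
  -- because 8B ≤ L.
  refine ⟨⌊L / (2 * B)⌋₊ - 1, by omega, ?_, ?_⟩
  · rw [Nat.cast_sub (by omega)]
    rw [le_div_iff₀ (by positivity)] at h1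
    push_cast
    linarith
  · rw [Nat.cast_sub (by omega)]
    rw [div_lt_iff₀ (by positivity)] at h2
    push_cast
    linarith

/-- The numbers of blocks and their masses can be chosen such that the union bound vanishes,
if there are no real components. -/
theorem eventually_exists_blocks_zero {α : ℕ → ℝ} (hα : Tendsto α atTop (𝓝 0)) {c κ U δ : ℝ}
    (hc : 0 < c) (hκ : 0 < κ) (hU : 0 < U) (hδ : 0 < δ) :
    ∀ᶠ L : ℝ in atTop, ∃ B r : ℕ, 1 ≤ r ∧ ((2 * B : ℕ) : ℝ) * (r + 1) ≤ κ * L ∧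
      κ * L / 4 ≤ B * r ∧ U * (Real.exp (-(c * B)) + B * α r) ≤ δ := by
  have hexp : Tendsto (fun B : ℕ => Real.exp (-(c * B))) atTop (𝓝 0) :=
    Real.tendsto_exp_neg_atTop_nhds_zero.comp
      (tendsto_natCast_atTop_atTop.const_mul_atTop hc)
  -- The order of choice matters: first B makes the exponential term small against U, then r₀ makes
  -- α(r) small against U·B.
  obtain ⟨B, hBexp, hB⟩ := ((hexp.eventually_lt_const (show 0 < δ / (2 * U) by positivity)).and
    (eventually_ge_atTop 1)).exists
  have hB0 : (0 : ℝ) < B := by exact_mod_cast hB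
  obtain ⟨r₀, hr₀⟩ := eventually_atTop.1
    (hα.eventually_lt_const (show 0 < δ / (2 * U * B) by positivity))
  filter_upwards [eventually_ge_atTop (8 * B / κ), eventually_ge_atTop (4 * B * r₀ / κ)]
    with L hL1 hL2
  rw [div_le_iff₀ hκ] at hL1 hL2
  obtain ⟨r, hr, hr1, hr2⟩ := exists_blockMass (L := κ * L) hB (by linarith)
  refine ⟨B, r, hr, hr1, hr2, ?_⟩
  have hrr : r₀ ≤ r := by
    have : (B : ℝ) * r₀ ≤ B * r := by linarith
    exact_mod_cast le_of_mul_le_mul_left this hB0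
  have h1 := (hr₀ r hrr).le
  have h2 : U * Real.exp (-(c * B)) ≤ δ / 2 := by
    refine (mul_le_mul_of_nonneg_left hBexp.le hU.le).trans (le_of_eq ?_)
    field_simp
  have h3 : U * (B * α r) ≤ δ / 2 := by
    refine (mul_le_mul_of_nonneg_left (mul_le_mul_of_nonneg_left h1 hB0.le) hU.le).trans
      (le_of_eq ?_)
    field_simp
  linarith

/-- The numbers of blocks and their masses can be chosen such that the union bound over
`y ^ (4 d)` cells vanishes, if `r ^ d α(r)` is bounded. -/
theorem eventually_exists_blocks_pos {α : ℕ → ℝ} {d : ℕ} (hd : 1 ≤ d)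
    {A : ℝ} (hα : ∀ r : ℕ, (r : ℝ) ^ d * α r ≤ A) (hA : 0 ≤ A) {c κ U δ : ℝ}
    (hc : 0 < c) (hκ : 0 < κ) (hU : 0 < U) (hδ : 0 < δ) :
    ∀ᶠ y : ℝ in atTop, ∃ B r : ℕ, 1 ≤ r ∧ ((2 * B : ℕ) : ℝ) * (r + 1) ≤ κ * y ^ 8 ∧
      κ * y ^ 8 / 4 ≤ B * r ∧ U * (y ^ 4) ^ d * (Real.exp (-(c * B)) + B * α r) ≤ δ := by
  have hexp : Tendsto (fun y : ℝ => U * ((y ^ 4) ^ d * Real.exp (-(c * y)))) atTop (𝓝 0) := by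
    have h := (tendsto_rpow_mul_exp_neg_mul_atTop_nhds_zero ((4 * d : ℕ) : ℝ) c hc).const_mul U
    rw [mul_zero] at h
    refine h.congr fun y => ?_
    rw [Real.rpow_natCast, pow_mul, neg_mul]
  have hpoly : Tendsto (fun y : ℝ => (U * (2 * A * (8 / κ) ^ d)) * y⁻¹) atTop (𝓝 0) := by
    have h := tendsto_inv_atTop_zero (𝕜 := ℝ) |>.const_mul (U * (2 * A * (8 / κ) ^ d))
    rwa [mul_zero] at h
  filter_upwards [hexp.eventually_le_const (half_pos hδ), hpoly.eventually_le_const (half_pos hδ),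
    eventually_ge_atTop 1, eventually_ge_atTop (16 / κ)] with y h1 h2 hy1 hyκ
  rw [div_le_iff₀ hκ] at hyκ
  have hy0 : 0 < y := by linarith
  -- The choice is B = ⌈y⌉, which forces r to be at least κy^7/8. Then e^(-cB) beats every power of
  -- y, and α(r) is O(y^(-7d)).
  have hBy := Nat.le_ceil y
  have hB2 : (⌈y⌉₊ : ℝ) ≤ 2 * y := by linarith [Nat.ceil_lt_add_one hy0.le]
  have hB : 1 ≤ ⌈y⌉₊ := Nat.one_le_ceil_iff.2 hy0
  have hy7 : 1 ≤ y ^ 7 := one_le_pow₀ hy1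
  have hy78 : y ≤ y ^ 7 := le_self_pow₀ hy1 (by norm_num)
  obtain ⟨r, hr, hr1, hr2⟩ := exists_blockMass (L := κ * y ^ 8) hB (by
    have : 16 * y ≤ κ * y ^ 7 * y := by nlinarith
    calc 8 * (⌈y⌉₊ : ℝ) ≤ 16 * y := by linarith
      _ ≤ κ * y ^ 7 * y := this
      _ = κ * y ^ 8 := by ring)
  refine ⟨⌈y⌉₊, r, hr, hr1, hr2, ?_⟩
  have hr0 : (0 : ℝ) < r := by exact_mod_cast hr
  have hrlow : κ / 8 * y ^ 7 ≤ r := by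
    have h3 : (⌈y⌉₊ : ℝ) * r ≤ 2 * y * r := mul_le_mul_of_nonneg_right hB2 hr0.le
    have h4 : y * (κ / 8 * y ^ 7) ≤ y * r := by nlinarith
    exact le_of_mul_le_mul_left h4 hy0
  have hαr : α r ≤ A * (8 / κ) ^ d * (y ^ (7 * d))⁻¹ := by
    have h3 : α r ≤ A / (r : ℝ) ^ d := by
      rw [le_div_iff₀ (by positivity), mul_comm]
      exact hα r
    refine h3.trans ?_
    have h5 : (κ / 8 * y ^ 7) ^ d ≤ (r : ℝ) ^ d := pow_le_pow_left₀ (by positivity) hrlow d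
    refine (div_le_div_of_nonneg_left hA (by positivity) h5).trans (le_of_eq ?_)
    rw [mul_pow, ← pow_mul, div_pow, div_pow]
    field_simp
  have hexple : Real.exp (-(c * (⌈y⌉₊ : ℝ))) ≤ Real.exp (-(c * y)) :=
    Real.exp_le_exp.2 (by nlinarith)
  have hBα : (⌈y⌉₊ : ℝ) * α r ≤ 2 * y * (A * (8 / κ) ^ d * (y ^ (7 * d))⁻¹) :=
    (mul_le_mul_of_nonneg_left hαr (Nat.cast_nonneg _)).trans
      (mul_le_mul_of_nonneg_right hB2 (by positivity))
  have hpow : (y ^ 4) ^ d * (2 * y * (A * (8 / κ) ^ d * (y ^ (7 * d))⁻¹)) ≤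
      2 * A * (8 / κ) ^ d * y⁻¹ := by
    -- This amounts to 4d + 2 ≤ 7d, which is where d ≥ 1 enters.
    have h6 : (y ^ 4) ^ d * y * (y ^ (7 * d))⁻¹ ≤ y⁻¹ := by
      rw [← div_eq_mul_inv, div_le_iff₀ (by positivity), ← pow_mul, le_inv_mul_iff₀ hy0,
        ← pow_succ, ← pow_succ']
      exact pow_le_pow_right₀ hy1 (by omega)
    have h7 := mul_le_mul_of_nonneg_left h6 (show 0 ≤ 2 * A * (8 / κ) ^ d by positivity)
    linarith
  calc U * (y ^ 4) ^ d * (Real.exp (-(c * (⌈y⌉₊ : ℝ))) + ⌈y⌉₊ * α r)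
      = U * ((y ^ 4) ^ d * (Real.exp (-(c * (⌈y⌉₊ : ℝ))) + ⌈y⌉₊ * α r)) := by ring
    _ ≤ U * ((y ^ 4) ^ d *
          (Real.exp (-(c * y)) + 2 * y * (A * (8 / κ) ^ d * (y ^ (7 * d))⁻¹))) := by
        rw [← mul_assoc, ← mul_assoc]
        exact mul_le_mul_of_nonneg_left (add_le_add hexple hBα) (by positivity)
    _ ≤ δ := by
        have := mul_le_mul_of_nonneg_left hpow hU.le
        linarith

end Asymptotics

end MixedIsotonic

/-! ### Assembly of the tail bound, the rates and the union bound. -/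

theorem lemma3p1 {Ω : Type*} [MeasurableSpace Ω] (P : Measure Ω) [IsProbabilityMeasure P]
    (d₁ d₂ : ℕ) (hd : 0 < d₁ + d₂)
    (X : ℕ → ℕ → Ω → Fin d₁ → ℕ) (Z : ℕ → ℕ → Ω → Fin d₂ → ℝ) (ε : ℕ → ℕ → Ω → ℝ)
    (hX : ∀ n t, 1 ≤ t → t ≤ n → Measurable (X n t))
    (hZ : ∀ n t, 1 ≤ t → t ≤ n → Measurable (Z n t))
    (hε : ∀ n t, 1 ≤ t → t ≤ n → Measurable (ε n t))
    (D : Set ((Fin d₁ → ℕ) × (Fin d₂ → ℝ))) (f : (Fin d₁ → ℕ) × (Fin d₂ → ℝ) → ℝ)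
    (G : Fin d₂ → ℝ → ℝ)
    (hA2 : MixedIsotonic.ErrorMixingAssumption P X Z ε D f)
    (hA3 : MixedIsotonic.DesignAssumption P X Z ε G)
    (q : Fin d₂ → ℝ → EReal) (hq : ∀ i, MixedIsotonic.IsInverseCDF (G i) (q i))
    (K : ℕ) :
    ∃ c : ℝ, 0 < c ∧ ∀ C₄ : ℝ, 0 < C₄ → C₄ ≤ c →
      Tendsto (fun n : ℕ => P (MixedIsotonic.cellEvent X Z q K C₄ n)) atTop (𝓝 1) := by
  open MixedIsotonic in
  obtain ⟨C₃, hC₃, hpair⟩ := hA3.exists_measureReal_inter_le hX hZ hε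
  obtain ⟨C₁, hC₁, hmass⟩ := hA3.exists_le_sum_measureReal K
  set α := strongMixingCoeff P (infoVar X Z)
  set c₀ : ℝ := 1 / (4 * (2 * (d₁ + d₂ : ℕ) + C₃)) with hc₀
  have hc₀0 : 0 < c₀ := by positivity
  -- The expected number of visits is at least 2κy^8 - 1 with y = `rate d₂ n`; halving the constant
  -- absorbs the -1 as soon as κy^8 ≥ 1.
  set κ : ℝ := C₁ / 2 ^ d₂ / 2 with hκ
  have hκ0 : 0 < κ := by positivity
  -- The tail bound controls counts below (c₀/8)·B·r, the blocks satisfy B·r ≥ κy^8/4, and y^8 =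
  -- n^(2/(d₂+2)).
  refine ⟨c₀ / 8 * (κ / 4), by positivity, fun C₄ _ hC₄ => ?_⟩
  have hbound : ∀ δ : ℝ, 0 < δ → ∀ᶠ n in atTop, P.real (cellEvent X Z q K C₄ n)ᶜ ≤ δ := by
    intro δ hδ
    have hex : ∀ᶠ n in atTop, ∃ B r : ℕ, 1 ≤ r ∧
        ((2 * B : ℕ) : ℝ) * (r + 1) ≤ κ * rate d₂ n ^ 8 ∧ κ * rate d₂ n ^ 8 / 4 ≤ B * r ∧
        ((K : ℝ) + 1) ^ d₁ * (rate d₂ n ^ 4) ^ d₂ *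
          (Real.exp (-(c₀ / 4 * B)) + B * α r) ≤ δ := by
      rcases Nat.eq_zero_or_pos d₂ with h0 | hpos
      · have h := eventually_exists_blocks_zero (c := c₀ / 4) (κ := κ) (U := ((K : ℝ) + 1) ^ d₁)
          (δ := δ) hA2.mixing (by positivity) hκ0 (by positivity) hδ
        filter_upwards [((tendsto_pow_atTop (by norm_num : (8 : ℕ) ≠ 0)).comp
          (tendsto_rate d₂)).eventually h] with n hn
        simpa [h0] using hn
      · obtain ⟨A, hA, hαA⟩ := exists_pow_mul_strongMixingCoeff_le P (infoVar X Z) hpos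
          hA2.summable_mixing
        exact (tendsto_rate d₂).eventually (eventually_exists_blocks_pos hpos hαA hA
          (by positivity) hκ0 (by positivity) hδ)
    filter_upwards [hex, (tendsto_rate d₂).eventually_ge_atTop 1,
      (tendsto_rate d₂).eventually_ge_atTop (1 / κ), eventually_ge_atTop 1]
      with n hn hrate hrateκ hn1
    obtain ⟨B, r, hr, hBr, hrB, hδn⟩ := hn
    have hα0 : 0 ≤ α r := strongMixingCoeff_nonneg P (infoVar X Z) r
    have hM : 1 ≤ gridSize d₂ n := one_le_gridSize hrate
    refine (measureReal_compl_cellEvent_le (P := P) (δ := Real.exp (-(c₀ / 4 * B)) + B * α r)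
      ?_).trans (le_trans ?_ hδn)
    · intro k l hk hl
      obtain ⟨a, b, hab, hsub, hG⟩ := exists_box_subset_cell hA3.isContinuousCDF hq k hM hl
      refine ⟨box k a b, hsub, ?_⟩
      have hm := hmass n hn1 k hk a b hab _ (by positivity) hG
      have hvol := mul_le_mul_of_nonneg_left (le_mul_half_cell hrate) hC₁.le
      have h8 : 1 ≤ κ * rate d₂ n ^ 8 := by
        rw [div_le_iff₀ hκ0] at hrateκ
        have := le_self_pow₀ hrate (show 8 ≠ 0 by norm_num)
        nlinarith
      have hκ2 : C₁ * (rate d₂ n ^ 8 / 2 ^ d₂) = 2 * (κ * rate d₂ n ^ 8) := by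
        rw [hκ]
        ring
      refine (measureReal_mono ?_).trans
        (measureReal_eventCount_lt_le_exp P (V := infoVar X Z n) (n := n) (d := d₁ + d₂) (r := r)
          (B := B) (a := α r) (fun t h1 h2 => (hX n t h1 h2).prodMk (hZ n t h1 h2))
          (measurableSet_box k a b) hC₃ hr hα0
          (fun m A A' h1 h2 hA hA' => abs_sub_le_strongMixingCoeff P (infoVar X Z) h1 h2 hA hA')
          (fun s t h1 h2 h3 => hpair n s t h1 h2 h3 k a b) (by linarith) hc₀)
      intro ω hω
      refine lt_of_lt_of_le (Set.mem_ofPred_eq ▸ hω) ?_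
      rw [← rate_pow_eight]
      have h9 : C₄ * rate d₂ n ^ 8 ≤ c₀ / 8 * (κ / 4) * rate d₂ n ^ 8 :=
        mul_le_mul_of_nonneg_right hC₄ (by positivity)
      have h10 := mul_le_mul_of_nonneg_left hrB (show 0 ≤ c₀ / 8 by positivity)
      linarith
    · refine mul_le_mul_of_nonneg_right (mul_le_mul_of_nonneg_left
        (pow_le_pow_left₀ (Nat.cast_nonneg _) (gridSize_le d₂ n) d₂) (by positivity)) ?_
      positivity
  have hreal : Tendsto (fun n => P.real (cellEvent X Z q K C₄ n)) atTop (𝓝 1) := by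
    rw [Metric.tendsto_atTop']
    intro δ hδ
    obtain ⟨N, hN⟩ := eventually_atTop.1 (hbound (δ / 2) (half_pos hδ))
    refine ⟨N, fun n hn => ?_⟩
    have h1 := hN n hn.le
    -- Subadditivity is enough here, so measurability of the cell event plays no role.
    have h2 : 1 ≤ P.real (cellEvent X Z q K C₄ n) + P.real (cellEvent X Z q K C₄ n)ᶜ := by
      rw [← probReal_univ (μ := P), ← Set.union_compl_self (cellEvent X Z q K C₄ n)]
      exact measureReal_union_le _ _
    have h3 : P.real (cellEvent X Z q K C₄ n) ≤ 1 := measureReal_le_one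
    rw [Real.dist_eq, abs_lt]
    constructor <;> linarith
  have h := ENNReal.tendsto_ofReal hreal
  rw [ENNReal.ofReal_one] at h
  exact h.congr fun n => ofReal_measureReal
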